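/- Let $\mathbb D=\{z\in\mathbb C:|z|<1\}$ and put, for $z\in\mathbb D$, $$v_{\log}(z)=(1-|z|)\log\frac{2}{1-|z|},\qquad w_{\log}(z)=\Big[\log\log\frac{4}{1-|z|^2}\Big]^{-1}.$$ For a weight $w:\mathbb D\to(0,\infty)$ and a holomorphic function $f$ on $\mathbb D$ let $$\|f\|_{\mathcal Z^{w}}=|f(0)|+|f'(0)|+\sup_{z\in\mathbb D}w(z)|f''(z)|\in[0,\infty],$$ and let $\mathcal Z^{v_{\log}}$ be the normed space of all holomorphic $f:\mathbb D\to\mathbb C$ with $\|f\|_{\mathcal Z^{v_{\log}}}<\infty$. Let $g_n(z)=z^n$. For holomorphic $u,f:\mathbb D\to\mathbb C$ put $$I_uf(z)=\int_0^z f'(s)u(s)\,ds,\quad J_uf(z)=\int_0^z f(s)u'(s)\,ds,\quad I'_uf(z)=\int_0^z I_uf(s)\,ds,\quad J'_uf(z)=\int_0^z J_uf(s)\,ds.$$ Let $\varphi:\mathbb D\to\mathbb D$ be holomorphic. Then the composition operator $C_\varphi f=f\circ\varphi$ is compact on $\mathcal Z^{v_{\log}}$ (that is, it maps $\mathcal Z^{v_{\log}}$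 into itself and is a compact operator there) if and only if all the norms $\|J'_{\varphi'}(\varphi^n)\|_{\mathcal Z^{v_{\log}}}$ and $\|I'_{\varphi'}(\varphi^n)\|_{\mathcal Z^{v_{\log}}}$, $n=0,1,2,\dots$, are finite and $$\lim_{n\to\infty}\frac{(n+2)(n+1)\,\|J'_{\varphi'}(\varphi^n)\|_{\mathcal Z^{v_{\log}}}}{\|g_{n+2}\|_{\mathcal Z^{w_{\log}}}}=0 \quad\text{and}\quad \lim_{n\to\infty}\frac{(n+1)\,\|I'_{\varphi'}(\varphi^n)\|_{\mathcal Z^{v_{\log}}}}{\|g_{n+1}\|_{\mathcal Z^{v_{\log}}}}=0.$$ -/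

import Mathlib

open Filter Topology
open scoped ENNReal Complex.UnitDisc

noncomputable section

namespace LogZygmund

/-- Extension of a function on the open unit disc to the plane, by zero outside the disc.
It is only ever used at points of the disc. -/
def toPlane (f : 𝔻 → ℂ) : ℂ → ℂ := Function.extend Complex.UnitDisc.coe f 0

/-- `f` is holomorphic on the open unit disc. -/
def IsHolo (f : 𝔻 → ℂ) : Prop := DifferentiableOn ℂ (toPlane f) (Metric.ball 0 1)

/-- The complex derivative of a function on the disc. -/
def der (f : 𝔻 → ℂ) : 𝔻 → ℂ := fun z => deriv (toPlane f) z

/-- The function `z ↦ ∫₀ᶻ f(s) ds`, the integral being taken along the segment from `0` to `z`. -/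
def primitive (f : 𝔻 → ℂ) : 𝔻 → ℂ :=
  fun z => (z : ℂ) * ∫ t in (0 : ℝ)..1, toPlane f ((t : ℂ) * z)

/-- `(I_u f)(z) = ∫₀ᶻ f'(s) u(s) ds`. -/
def opI (u f : 𝔻 → ℂ) : 𝔻 → ℂ := primitive (fun s => der f s * u s)

/-- `(J_u f)(z) = ∫₀ᶻ f(s) u'(s) ds`. -/
def opJ (u f : 𝔻 → ℂ) : 𝔻 → ℂ := primitive (fun s => f s * der u s)

/-- `(I'_u f)(z) = ∫₀ᶻ (I_u f)(s) ds`. -/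
def opI' (u f : 𝔻 → ℂ) : 𝔻 → ℂ := primitive (opI u f)

/-- `(J'_u f)(z) = ∫₀ᶻ (J_u f)(s) ds`. -/
def opJ' (u f : 𝔻 → ℂ) : 𝔻 → ℂ := primitive (opJ u f)

/-- The logarithmic weight `v_log(z) = (1 - |z|) log (2 / (1 - |z|))`. -/
def vLog (z : 𝔻) : ℝ := (1 - ‖(z : ℂ)‖) * Real.log (2 / (1 - ‖(z : ℂ)‖))

/-- The weight `w_log(z) = 1 / log (log (4 / (1 - |z|²)))`. -/
def wLog (z : 𝔻) : ℝ := (Real.log (Real.log (4 / (1 - ‖(z : ℂ)‖ ^ 2))))⁻¹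

/-- The Zygmund-type norm `|f(0)| + |f'(0)| + sup_z w(z) |f''(z)|`, with values in `[0, ∞]`. -/
def zygENorm (w : 𝔻 → ℝ) (f : 𝔻 → ℂ) : ℝ≥0∞ :=
  ‖f 0‖ₑ + ‖der f 0‖ₑ + ⨆ z : 𝔻, ENNReal.ofReal (w z) * ‖der (der f) z‖ₑ

/-- The power function `g_n(z) = z ^ n`. -/
def power (n : ℕ) : 𝔻 → ℂ := fun z => (z : ℂ) ^ n

/-! ### The space `Z^{v_log}` -/

theorem toPlane_coe (f : 𝔻 → ℂ) (z : 𝔻) : toPlane f z = f z :=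
  Complex.UnitDisc.coe_injective.extend_apply f 0 z

theorem toPlane_add (f g : 𝔻 → ℂ) : toPlane (f + g) = toPlane f + toPlane g := by
  simpa [toPlane] using Function.extend_add Complex.UnitDisc.coe f g (0 : ℂ → ℂ) 0

theorem toPlane_smul (c : ℂ) (f : 𝔻 → ℂ) : toPlane (c • f) = c • toPlane f := by
  simpa [toPlane] using Function.extend_smul c Complex.UnitDisc.coe f (0 : ℂ → ℂ)

theorem coe_mem_ball (z : 𝔻) : (z : ℂ) ∈ Metric.ball (0 : ℂ) 1 :=
  mem_ball_zero_iff.2 z.norm_lt_one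

theorem IsHolo.differentiableAt {f : 𝔻 → ℂ} (hf : IsHolo f) (z : 𝔻) :
    DifferentiableAt ℂ (toPlane f) z :=
  DifferentiableOn.differentiableAt hf (Metric.isOpen_ball.mem_nhds (coe_mem_ball z))

theorem IsHolo.add {f g : 𝔻 → ℂ} (hf : IsHolo f) (hg : IsHolo g) : IsHolo (f + g) := by
  unfold IsHolo
  rw [toPlane_add]
  exact DifferentiableOn.add hf hg

theorem IsHolo.smul {f : 𝔻 → ℂ} (c : ℂ) (hf : IsHolo f) : IsHolo (c • f) := by
  unfold IsHolo
  rw [toPlane_smul]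
  exact DifferentiableOn.const_smul hf c

theorem toPlane_der_eqOn (f : 𝔻 → ℂ) : Set.EqOn (toPlane (der f)) (deriv (toPlane f)) (Metric.ball 0 1) := by
  intro z hz
  lift z to 𝔻 using mem_ball_zero_iff.1 hz
  exact toPlane_coe (der f) z

theorem IsHolo.der {f : 𝔻 → ℂ} (hf : IsHolo f) : IsHolo (der f) :=
  (DifferentiableOn.deriv hf Metric.isOpen_ball).congr (toPlane_der_eqOn f)

theorem der_add {f g : 𝔻 → ℂ} (hf : IsHolo f) (hg : IsHolo g) :
    der (f + g) = der f + der g := by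
  funext z
  simp only [LogZygmund.der, Pi.add_apply]
  rw [toPlane_add, deriv_add (hf.differentiableAt z) (hg.differentiableAt z)]

theorem der_smul {f : 𝔻 → ℂ} (c : ℂ) (hf : IsHolo f) : der (c • f) = c • der f := by
  funext z
  simp only [LogZygmund.der, Pi.smul_apply]
  rw [toPlane_smul, deriv_const_smul c (hf.differentiableAt z)]

theorem isHolo_zero : IsHolo 0 := by
  have h := toPlane_smul 0 0
  rw [zero_smul, zero_smul] at h
  unfold IsHolo
  rw [h]
  exact differentiableOn_const 0

theorem zygENorm_add_le (w : 𝔻 → ℝ) {f g : 𝔻 → ℂ} (hf : IsHolo f) (hg : IsHolo g) :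
    zygENorm w (f + g) ≤ zygENorm w f + zygENorm w g := by
  unfold zygENorm
  rw [der_add hf hg, der_add hf.der hg.der]
  have h : (⨆ z : 𝔻, ENNReal.ofReal (w z) * ‖(der (der f) + der (der g)) z‖ₑ) ≤
      (⨆ z : 𝔻, ENNReal.ofReal (w z) * ‖der (der f) z‖ₑ) +
        ⨆ z : 𝔻, ENNReal.ofReal (w z) * ‖der (der g) z‖ₑ := by
    refine iSup_le fun z => ?_
    refine le_trans ?_ (add_le_add
      (le_iSup (fun z : 𝔻 => ENNReal.ofReal (w z) * ‖der (der f) z‖ₑ) z)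
      (le_iSup (fun z : 𝔻 => ENNReal.ofReal (w z) * ‖der (der g) z‖ₑ) z))
    rw [← mul_add]
    gcongr
    exact enorm_add_le _ _
  refine (add_le_add (add_le_add (enorm_add_le (f 0) (g 0))
    (enorm_add_le (der f 0) (der g 0))) h).trans (le_of_eq ?_)
  ring

theorem zygENorm_smul (w : 𝔻 → ℝ) (c : ℂ) {f : 𝔻 → ℂ} (hf : IsHolo f) :
    zygENorm w (c • f) = ‖c‖ₑ * zygENorm w f := by
  unfold zygENorm
  rw [der_smul c hf, der_smul c hf.der]
  simp only [Pi.smul_apply, smul_eq_mul, enorm_mul, mul_add, ENNReal.mul_iSup]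
  congr 2
  funext z
  ring

theorem vLog_pos (z : 𝔻) : 0 < vLog z := by
  have h0 := norm_nonneg (z : ℂ)
  have h1 := z.norm_lt_one
  have h2 : 0 < 1 - ‖(z : ℂ)‖ := by linarith
  refine mul_pos h2 (Real.log_pos ?_)
  rw [lt_div_iff₀ h2]
  linarith

theorem const_of_der_eq_zero {f : 𝔻 → ℂ} (hf : IsHolo f) (h : ∀ z, der f z = 0) (h0 : f 0 = 0)
    (z : 𝔻) : f z = 0 := by
  have key := Metric.isOpen_ball.is_const_of_deriv_eq_zero
    (convex_ball (0 : ℂ) 1).isPreconnected hf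
    (fun x hx => by
      lift x to 𝔻 using mem_ball_zero_iff.1 hx
      exact h x)
    (coe_mem_ball z) (coe_mem_ball 0)
  rwa [toPlane_coe, toPlane_coe, h0] at key

theorem eq_zero_of_zygENorm_eq_zero {f : 𝔻 → ℂ} (hf : IsHolo f) (h : zygENorm vLog f = 0) :
    f = 0 := by
  unfold zygENorm at h
  simp only [add_eq_zero, enorm_eq_zero, ENNReal.iSup_eq_zero, mul_eq_zero,
    ENNReal.ofReal_eq_zero] at h
  obtain ⟨⟨h0, h1⟩, h2⟩ := h
  have h3 := const_of_der_eq_zero hf.der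
    (fun z => (h2 z).resolve_left (not_le.2 (vLog_pos z))) h1
  exact funext (const_of_der_eq_zero hf h3 h0)

theorem zygENorm_zero (w : 𝔻 → ℝ) : zygENorm w 0 = 0 := by
  have h := zygENorm_smul w 0 isHolo_zero
  simpa using h

/-- The functions of `Z^{v_log}`: holomorphic on the disc, with finite norm. -/
def zygmundSubmodule : Submodule ℂ (𝔻 → ℂ) where
  carrier := {f | IsHolo f ∧ zygENorm vLog f < ∞}
  add_mem' := fun hf hg =>
    ⟨hf.1.add hg.1, (zygENorm_add_le _ hf.1 hg.1).trans_lt (ENNReal.add_lt_top.2 ⟨hf.2, hg.2⟩)⟩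
  zero_mem' := ⟨isHolo_zero, by rw [zygENorm_zero]; exact ENNReal.zero_lt_top⟩
  smul_mem' := fun c f hf =>
    ⟨hf.1.smul c, by rw [zygENorm_smul _ c hf.1]; exact ENNReal.mul_lt_top enorm_lt_top hf.2⟩

/-- The logarithmic Zygmund space `Z^{v_log}`. It is a separate type, so that its topology is the
one of its norm and not the one of pointwise convergence. -/
def ZygmundSpace : Type := ↥zygmundSubmodule

instance : AddCommGroup ZygmundSpace := inferInstanceAs (AddCommGroup ↥zygmundSubmodule)

instance : Module ℂ ZygmundSpace := inferInstanceAs (Module ℂ ↥zygmundSubmodule)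

/-- An element of `Z^{v_log}` as a function on the disc. -/
def ZygmundSpace.toFun (f : ZygmundSpace) : 𝔻 → ℂ := f.1

instance : CoeFun ZygmundSpace (fun _ => 𝔻 → ℂ) := ⟨ZygmundSpace.toFun⟩

theorem ZygmundSpace.isHolo (f : ZygmundSpace) : IsHolo f.toFun := f.2.1

theorem ZygmundSpace.zygENorm_lt_top (f : ZygmundSpace) : zygENorm vLog f.toFun < ∞ := f.2.2

instance : Norm ZygmundSpace := ⟨fun f => (zygENorm vLog f.toFun).toReal⟩

theorem zygmundSpace_core : NormedSpace.Core ℂ ZygmundSpace where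
  norm_nonneg f := ENNReal.toReal_nonneg
  norm_smul c f := by
    change (zygENorm vLog (c • f.toFun)).toReal = ‖c‖ * (zygENorm vLog f.toFun).toReal
    rw [zygENorm_smul vLog c f.isHolo, ENNReal.toReal_mul, toReal_enorm]
  norm_triangle f g := by
    change (zygENorm vLog (f.toFun + g.toFun)).toReal ≤
      (zygENorm vLog f.toFun).toReal + (zygENorm vLog g.toFun).toReal
    rw [← ENNReal.toReal_add f.zygENorm_lt_top.ne g.zygENorm_lt_top.ne]
    exact ENNReal.toReal_mono (ENNReal.add_lt_top.2 ⟨f.zygENorm_lt_top, g.zygENorm_lt_top⟩).ne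
      (zygENorm_add_le vLog f.isHolo g.isHolo)
  norm_eq_zero_iff f := by
    change (zygENorm vLog f.toFun).toReal = 0 ↔ f = 0
    constructor
    · intro h
      have h' := (ENNReal.toReal_eq_zero_iff _).1 h
      exact Subtype.ext (eq_zero_of_zygENorm_eq_zero f.isHolo (h'.resolve_right f.zygENorm_lt_top.ne))
    · rintro rfl
      change (zygENorm vLog 0).toReal = 0
      rw [zygENorm_zero, ENNReal.toReal_zero]

instance : NormedAddCommGroup ZygmundSpace := NormedAddCommGroup.ofCore zygmundSpace_core

instance : NormedSpace ℂ ZygmundSpace := NormedSpace.ofCore zygmundSpace_core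

/-- The composition operator `C_φ f = f ∘ φ` maps `Z^{v_log}` into itself and is a compact
operator on this normed space. -/
def IsCompactComposition (φ : 𝔻 → 𝔻) : Prop :=
  ∃ T : ZygmundSpace →L[ℂ] ZygmundSpace,
    (∀ (f : ZygmundSpace) (z : 𝔻), T f z = f (φ z)) ∧ IsCompactOperator T

end LogZygmund

end

open LogZygmund

/-!
# Compact composition operators on the logarithmic Zygmund space

Write `q₁ = v_log |φ'|²` and `q₂ = v_log |φ''|`. Both sides of the equivalence are reduced to the
same pointwise statement: `q₁` and `q₂` are bounded, and `q₁ / (v_log ∘ φ)` and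
`q₂ / (w_log ∘ φ)` tend to zero as `|φ(z)| → 1` (`BoundaryVanishing`).

*Norms of powers.* Differentiating twice gives `‖J'_{φ'}(φⁿ)‖ = sup q₂ |φ|ⁿ` and
`‖I'_{φ'}(φⁿ⁺¹)‖ = (n + 1) sup q₁ |φ|ⁿ`, while `‖g_{n+2}‖ = (n + 2)(n + 1) sup w(z) |z|ⁿ`. The
quotients in the theorem are therefore quotients of two such suprema (`powSup`). Both weights are so
regular (`SlowWeight`) that `sup w(z) |z|ⁿ` with `n = ⌊1 / (1 - |a|)⌋` is at most a constant times
`w(a)`, while `|a|ⁿ` is bounded below; hence the quotients tend to zero exactly when `q / (w ∘ φ)`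
does near the boundary (`boundaryVanishing_of_tendsto`, `tendsto_of_boundaryVanishing`).

*Decay implies compactness.* Integrating `|f''| ≤ ‖f‖ / v_log` along radii gives
`|f'| ≤ 9 ‖f‖ / w_log` (`norm_der_le`). As `(f ∘ φ)'' = f''(φ) φ'² + f'(φ) φ''`, the part of the
norm of `f ∘ φ` coming from points with `|φ(z)|` near `1` is small uniformly on the unit ball, and on the
rest the operator is continuous for locally uniform convergence. The unit ball is compact for the
latter (`exists_tendstoLocUnif`), so its image is compact in norm.

*Compactness implies decay.* Applying the operator to `z` and `z²` bounds `q₁` and `q₂`. A compact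
operator sends a bounded family tending to zero locally uniformly to a family tending to zero in
norm. The functions with derivative `peak a` have vanishing first and large second derivative at
`a`, which gives the decay of `q₁`; those with derivative `slowPeak a` have first derivative
`1 / w_log(a)` at `a`, which, with the decay of `q₁`, gives that of `q₂`.
-/

namespace LogZygmund

/-! ### Calculus of holomorphic functions on the disc -/

theorem toPlane_eqOn {f : 𝔻 → ℂ} {g : ℂ → ℂ} (h : ∀ z : 𝔻, f z = g z) :
    Set.EqOn (toPlane f) g (Metric.ball 0 1) := by
  intro z hz
  lift z to 𝔻 using mem_ball_zero_iff.1 hz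
  rw [toPlane_coe, h]

theorem ball_mem_nhds_coe (z : 𝔻) : Metric.ball (0 : ℂ) 1 ∈ 𝓝 (z : ℂ) :=
  Metric.isOpen_ball.mem_nhds (coe_mem_ball z)

theorem isHolo_of_differentiableOn {f : 𝔻 → ℂ} {g : ℂ → ℂ} (h : ∀ z : 𝔻, f z = g z)
    (hg : DifferentiableOn ℂ g (Metric.ball 0 1)) : IsHolo f :=
  hg.congr (toPlane_eqOn h)

theorem der_eq_of_hasDerivAt {f : 𝔻 → ℂ} {g : ℂ → ℂ} (h : ∀ z : 𝔻, f z = g z) {z : 𝔻} {c : ℂ}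
    (hg : HasDerivAt g c z) : der f z = c :=
  (((toPlane_eqOn h).eventuallyEq_of_mem (ball_mem_nhds_coe z)).hasDerivAt_iff.2 hg).deriv

theorem IsHolo.hasDerivAt {f : 𝔻 → ℂ} (hf : IsHolo f) (z : 𝔻) :
    HasDerivAt (toPlane f) (LogZygmund.der f z) z :=
  (hf.differentiableAt z).hasDerivAt

theorem IsHolo.mul {f g : 𝔻 → ℂ} (hf : IsHolo f) (hg : IsHolo g) : IsHolo (fun z => f z * g z) :=
  isHolo_of_differentiableOn (g := fun z => toPlane f z * toPlane g z)
    (fun z => by simp only [toPlane_coe]) (DifferentiableOn.fun_mul hf hg)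

theorem der_mul {f g : 𝔻 → ℂ} (hf : IsHolo f) (hg : IsHolo g) (z : 𝔻) :
    der (fun z => f z * g z) z = der f z * g z + f z * der g z := by
  have h := (hf.hasDerivAt z).fun_mul (hg.hasDerivAt z)
  simp only [toPlane_coe] at h
  exact der_eq_of_hasDerivAt (fun z => by simp only [toPlane_coe]) h

theorem IsHolo.pow {f : 𝔻 → ℂ} (hf : IsHolo f) (n : ℕ) : IsHolo (fun z => f z ^ n) :=
  isHolo_of_differentiableOn (g := fun z => toPlane f z ^ n)
    (fun z => by simp only [toPlane_coe]) (DifferentiableOn.fun_pow hf n)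

theorem der_pow {f : 𝔻 → ℂ} (hf : IsHolo f) (n : ℕ) (z : 𝔻) :
    der (fun z => f z ^ n) z = n * f z ^ (n - 1) * der f z := by
  have h := (hf.hasDerivAt z).fun_pow n
  simp only [toPlane_coe] at h
  exact der_eq_of_hasDerivAt (fun z => by simp only [toPlane_coe]) h

theorem isHolo_coe : IsHolo (fun z => (z : ℂ)) :=
  isHolo_of_differentiableOn (g := id) (fun _ => rfl) differentiableOn_id

theorem der_coe (z : 𝔻) : der (fun z => (z : ℂ)) z = 1 :=
  der_eq_of_hasDerivAt (g := id) (fun _ => rfl) (hasDerivAt_id _)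

theorem der_sub {f g : 𝔻 → ℂ} (hf : IsHolo f) (hg : IsHolo g) : der (f - g) = der f - der g := by
  have h := der_add hf (hg.smul (-1))
  rwa [der_smul _ hg, neg_one_smul, neg_one_smul, ← sub_eq_add_neg, ← sub_eq_add_neg] at h

section Comp

variable {φ : 𝔻 → 𝔻} {f : 𝔻 → ℂ}

theorem toPlane_comp (f : 𝔻 → ℂ) (φ : 𝔻 → 𝔻) (z : 𝔻) :
    f (φ z) = (toPlane f ∘ toPlane (fun z => (φ z : ℂ))) z := by
  rw [Function.comp_apply, toPlane_coe, toPlane_coe]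

theorem IsHolo.comp (hf : IsHolo f) (hφ : IsHolo (fun z => (φ z : ℂ))) :
    IsHolo (fun z => f (φ z)) := by
  refine isHolo_of_differentiableOn (toPlane_comp f φ) (DifferentiableOn.comp hf hφ ?_)
  intro z hz
  rw [toPlane_eqOn (fun z => (toPlane_coe _ z).symm) hz]
  lift z to 𝔻 using mem_ball_zero_iff.1 hz
  rw [toPlane_coe]
  exact coe_mem_ball _

theorem der_comp (hf : IsHolo f) (hφ : IsHolo (fun z => (φ z : ℂ))) (z : 𝔻) :
    der (fun z => f (φ z)) z = der f (φ z) * der (fun z => (φ z : ℂ)) z := by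
  refine der_eq_of_hasDerivAt (toPlane_comp f φ) (HasDerivAt.comp _ ?_ (hφ.hasDerivAt z))
  rw [toPlane_coe]
  exact hf.hasDerivAt (φ z)

theorem der_der_comp (hf : IsHolo f) (hφ : IsHolo (fun z => (φ z : ℂ))) (z : 𝔻) :
    der (der (fun z => f (φ z))) z =
      der (der f) (φ z) * der (fun z => (φ z : ℂ)) z ^ 2 +
        der f (φ z) * der (der (fun z => (φ z : ℂ))) z := by
  rw [show der (fun z => f (φ z)) = fun z => der f (φ z) * der (fun z => (φ z : ℂ)) z from
    funext (der_comp hf hφ), der_mul (hf.der.comp hφ) hφ.der, der_comp hf.der hφ]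
  ring

end Comp

/-- The integral along segments agrees with a primitive given by the simple connectedness of the
disc. -/
theorem exists_hasDerivAt_primitive {f : 𝔻 → ℂ} (hf : IsHolo f) :
    ∃ g : ℂ → ℂ, (∀ z : 𝔻, primitive f z = g z) ∧
      ∀ z ∈ Metric.ball (0 : ℂ) 1, HasDerivAt g (toPlane f z) z := by
  obtain ⟨g, h0, hg⟩ := (DifferentiableOn.isExactOn_ball hf).with_val_at 0 0
  refine ⟨g, fun z => ?_, hg⟩
  have hmem : ∀ t ∈ Set.uIcc (0 : ℝ) 1, (t : ℂ) * z ∈ Metric.ball (0 : ℂ) 1 := by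
    intro t ht
    rw [Set.uIcc_of_le zero_le_one] at ht
    rw [mem_ball_zero_iff, norm_mul, Complex.norm_real, Real.norm_of_nonneg ht.1]
    exact (mul_le_of_le_one_left (norm_nonneg _) ht.2).trans_lt z.norm_lt_one
  have hline : ∀ t : ℝ, HasDerivAt (fun t : ℝ => (t : ℂ) * z) z t := fun t => by
    simpa using (Complex.ofRealCLM.hasDerivAt (x := t)).mul_const (z : ℂ)
  have hderiv : ∀ t ∈ Set.uIcc (0 : ℝ) 1,
      HasDerivAt (fun t : ℝ => g ((t : ℂ) * z)) (toPlane f ((t : ℂ) * z) * z) t :=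
    fun t ht => (hg _ (hmem t ht)).comp t (hline t)
  have hcont : ContinuousOn (fun t : ℝ => toPlane f ((t : ℂ) * z) * z) (Set.uIcc 0 1) :=
    ((DifferentiableOn.continuousOn hf).comp (by fun_prop) hmem).mul continuousOn_const
  have := intervalIntegral.integral_eq_sub_of_hasDerivAt hderiv hcont.intervalIntegrable
  rw [intervalIntegral.integral_mul_const] at this
  simp only [Complex.ofReal_one, one_mul, Complex.ofReal_zero, zero_mul, h0, sub_zero] at this
  rw [primitive, mul_comm, this]

theorem IsHolo.primitive {f : 𝔻 → ℂ} (hf : IsHolo f) : IsHolo (primitive f) := by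
  obtain ⟨g, h, hg⟩ := exists_hasDerivAt_primitive hf
  exact isHolo_of_differentiableOn h fun z hz => (hg z hz).differentiableAt.differentiableWithinAt

theorem der_primitive {f : 𝔻 → ℂ} (hf : IsHolo f) : der (primitive f) = f := by
  obtain ⟨g, h, hg⟩ := exists_hasDerivAt_primitive hf
  funext z
  rw [der_eq_of_hasDerivAt h (hg z (coe_mem_ball z)), toPlane_coe]

theorem primitive_zero (f : 𝔻 → ℂ) : primitive f 0 = 0 := by simp [primitive]

theorem norm_primitive_le {f : 𝔻 → ℂ} {z : 𝔻} {C : ℝ}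
    (h : ∀ w : 𝔻, ‖(w : ℂ)‖ ≤ ‖(z : ℂ)‖ → ‖f w‖ ≤ C) : ‖primitive f z‖ ≤ C := by
  have hC : 0 ≤ C := (norm_nonneg _).trans (h z le_rfl)
  have key : ‖∫ t in (0 : ℝ)..1, toPlane f ((t : ℂ) * z)‖ ≤ C * |(1 : ℝ) - 0| := by
    refine intervalIntegral.norm_integral_le_of_norm_le_const fun t ht => ?_
    rw [Set.uIoc_of_le zero_le_one] at ht
    have hle : ‖(t : ℂ) * z‖ ≤ ‖(z : ℂ)‖ := by
      rw [norm_mul, Complex.norm_real, Real.norm_of_nonneg ht.1.le]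
      exact mul_le_of_le_one_left (norm_nonneg _) ht.2
    have h1 := hle.trans_lt z.norm_lt_one
    lift (t : ℂ) * z to 𝔻 using h1 with w
    rw [toPlane_coe]
    exact h w hle
  rw [primitive, norm_mul]
  calc ‖(z : ℂ)‖ * _ ≤ 1 * (C * |(1 : ℝ) - 0|) := by
        gcongr
        exact z.norm_lt_one.le
    _ = C := by simp

/-! ### The norm of a Zygmund-type space -/

theorem zygENorm_of_zero {w : 𝔻 → ℝ} {f : 𝔻 → ℂ} (h0 : f 0 = 0) (h1 : der f 0 = 0) :
    zygENorm w f = ⨆ z : 𝔻, ENNReal.ofReal (w z) * ‖der (der f) z‖ₑ := by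
  simp [zygENorm, h0, h1]

theorem zygENorm_primitive_primitive {w : 𝔻 → ℝ} {f : 𝔻 → ℂ} (hf : IsHolo f) :
    zygENorm w (primitive (primitive f)) = ⨆ z : 𝔻, ENNReal.ofReal (w z) * ‖f z‖ₑ := by
  have h := der_primitive hf.primitive
  rw [zygENorm_of_zero (primitive_zero _) (by rw [h, primitive_zero]), h, der_primitive hf]

/-- `sup_z q(z) |ψ(z)| ^ n`, with values in `[0, ∞]`. -/
noncomputable def powSup (ψ : 𝔻 → 𝔻) (q : 𝔻 → ℝ) (n : ℕ) : ℝ≥0∞ :=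
  ⨆ z : 𝔻, ENNReal.ofReal (q z * ‖(ψ z : ℂ)‖ ^ n)

theorem ofReal_mul_enorm {r : ℝ} (hr : 0 ≤ r) (c : ℂ) :
    ENNReal.ofReal r * ‖c‖ₑ = ENNReal.ofReal (r * ‖c‖) := by
  rw [ENNReal.ofReal_mul hr, ofReal_norm]

section Operators

variable {φ : 𝔻 → 𝔻}

theorem zygENorm_opJ' (hφ : IsHolo (fun z => (φ z : ℂ))) (n : ℕ) :
    zygENorm vLog (opJ' (der (fun z => (φ z : ℂ))) (fun z => (φ z : ℂ) ^ n)) =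
      powSup φ (fun z => vLog z * ‖der (der (fun z => (φ z : ℂ))) z‖) n := by
  rw [opJ', opJ, zygENorm_primitive_primitive ((hφ.pow n).mul hφ.der.der)]
  refine iSup_congr fun z => ?_
  rw [ofReal_mul_enorm (vLog_pos z).le, norm_mul, norm_pow]
  congr 1
  ring

theorem zygENorm_opI'_zero (hφ : IsHolo (fun z => (φ z : ℂ))) :
    zygENorm vLog (opI' (der (fun z => (φ z : ℂ))) (fun z => (φ z : ℂ) ^ 0)) = 0 := by
  rw [opI', opI, zygENorm_primitive_primitive ((hφ.pow 0).der.mul hφ.der)]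
  have h := der_pow hφ 0
  simp only [Nat.cast_zero, zero_mul] at h
  simp only [h, zero_mul, enorm_zero, mul_zero, ENNReal.iSup_zero]

theorem zygENorm_opI'_succ (hφ : IsHolo (fun z => (φ z : ℂ))) (n : ℕ) :
    zygENorm vLog (opI' (der (fun z => (φ z : ℂ))) (fun z => (φ z : ℂ) ^ (n + 1))) =
      ((n : ℝ≥0∞) + 1) * powSup φ (fun z => vLog z * ‖der (fun z => (φ z : ℂ)) z‖ ^ 2) n := by
  rw [opI', opI, zygENorm_primitive_primitive ((hφ.pow _).der.mul hφ.der), powSup, ENNReal.mul_iSup]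
  refine iSup_congr fun z => ?_
  rw [ofReal_mul_enorm (vLog_pos z).le, der_pow hφ,
    show (n : ℝ≥0∞) + 1 = ENNReal.ofReal (n + 1) by
      rw [ENNReal.ofReal_add (by positivity) zero_le_one]; simp,
    ← ENNReal.ofReal_mul (by positivity)]
  congr 1
  simp only [norm_mul, norm_pow, Nat.add_sub_cancel]
  rw [Complex.norm_natCast]
  push_cast
  ring

theorem zygENorm_power_add_two {w : 𝔻 → ℝ} (hw : ∀ z, 0 ≤ w z) (n : ℕ) :
    zygENorm w (power (n + 2)) = ((n : ℝ≥0∞) + 2) * ((n : ℝ≥0∞) + 1) * powSup id w n := by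
  have h1 : ∀ m, der (power m) = fun z : 𝔻 => (m : ℂ) * power (m - 1) z := fun m => by
    funext z
    have := der_pow isHolo_coe m z
    rw [der_coe, mul_one] at this
    exact this
  have h2 : ∀ z, der (der (power (n + 2))) z = ((n + 2 : ℕ) : ℂ) * (((n + 1 : ℕ) : ℂ) * z ^ n) := by
    intro z
    have h := der_smul ((n + 2 : ℕ) : ℂ) (isHolo_coe.pow (n + 1))
    rw [h1 (n + 2)]
    refine (congrFun h z).trans ?_
    rw [Pi.smul_apply, smul_eq_mul]
    congr 1
    exact congrFun (h1 (n + 1)) z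
  rw [zygENorm_of_zero (by simp [power]) (by rw [h1]; simp [power]), powSup, ENNReal.mul_iSup]
  refine iSup_congr fun z => ?_
  rw [h2, ofReal_mul_enorm (hw z),
    show ((n : ℝ≥0∞) + 2) * ((n : ℝ≥0∞) + 1) = ENNReal.ofReal ((n + 2) * (n + 1)) by
      rw [ENNReal.ofReal_mul (by positivity), ENNReal.ofReal_add (by positivity) zero_le_one,
        ENNReal.ofReal_add (by positivity) zero_le_two]; simp,
    ← ENNReal.ofReal_mul (by positivity)]
  congr 1
  simp only [norm_mul, norm_pow, Complex.norm_natCast]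
  push_cast
  simp only [id]
  ring

end Operators

/-! ### The space `Z^{v_log}` -/

theorem norm_add_norm_add_le (f : ZygmundSpace) (z : 𝔻) :
    ‖f 0‖ + ‖der f.toFun 0‖ + vLog z * ‖der (der f.toFun) z‖ ≤ ‖f‖ := by
  refine (ENNReal.ofReal_le_iff_le_toReal f.zygENorm_lt_top.ne).1 ?_
  have hv := (vLog_pos z).le
  rw [ENNReal.ofReal_add (by positivity) (by positivity),
    ENNReal.ofReal_add (by positivity) (by positivity), ← ofReal_mul_enorm hv,
    ofReal_norm, ofReal_norm]
  exact add_le_add le_rfl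
    (le_iSup (fun z : 𝔻 => ENNReal.ofReal (vLog z) * ‖der (der f.toFun) z‖ₑ) z)

theorem norm_apply_zero_le (f : ZygmundSpace) : ‖f 0‖ ≤ ‖f‖ := by
  have h := norm_add_norm_add_le f 0
  have := (vLog_pos 0).le
  linarith [norm_nonneg (f 0), norm_nonneg (der f.toFun 0),
    mul_nonneg this (norm_nonneg (der (der f.toFun) 0))]

theorem norm_der_zero_le (f : ZygmundSpace) : ‖der f.toFun 0‖ ≤ ‖f‖ := by
  have h := norm_add_norm_add_le f 0
  have := (vLog_pos 0).le
  linarith [norm_nonneg (f 0), norm_nonneg (der f.toFun 0),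
    mul_nonneg this (norm_nonneg (der (der f.toFun) 0))]

theorem vLog_mul_norm_le (f : ZygmundSpace) (z : 𝔻) : vLog z * ‖der (der f.toFun) z‖ ≤ ‖f‖ := by
  have h := norm_add_norm_add_le f z
  linarith [norm_nonneg (f 0), norm_nonneg (der f.toFun 0)]

theorem zygENorm_vLog_le {f : 𝔻 → ℂ} {C : ℝ}
    (h : ∀ z, ‖f 0‖ + ‖der f 0‖ + vLog z * ‖der (der f) z‖ ≤ C) :
    zygENorm vLog f ≤ ENNReal.ofReal C := by
  rw [zygENorm, ENNReal.add_iSup]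
  refine iSup_le fun z => ?_
  have hv := (vLog_pos z).le
  rw [ofReal_mul_enorm hv, ← ofReal_norm, ← ofReal_norm,
    ← ENNReal.ofReal_add (by positivity) (by positivity),
    ← ENNReal.ofReal_add (by positivity) (by positivity)]
  exact ENNReal.ofReal_le_ofReal (h z)

theorem norm_le_of_forall {f : ZygmundSpace} {C : ℝ}
    (h : ∀ z, ‖f 0‖ + ‖der f.toFun 0‖ + vLog z * ‖der (der f.toFun) z‖ ≤ C) : ‖f‖ ≤ C := by
  have hC : 0 ≤ C := le_trans (by have := (vLog_pos 0).le; positivity) (h 0)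
  exact ENNReal.toReal_le_of_le_ofReal hC (zygENorm_vLog_le h)

/-- The element of `Z^{v_log}` given by a holomorphic function whose norm has a finite bound. -/
def ZygmundSpace.ofBound (f : 𝔻 → ℂ) (hf : IsHolo f) (C : ℝ)
    (h : ∀ z, ‖f 0‖ + ‖der f 0‖ + vLog z * ‖der (der f) z‖ ≤ C) : ZygmundSpace :=
  ⟨f, hf, (zygENorm_vLog_le h).trans_lt ENNReal.ofReal_lt_top⟩

theorem ZygmundSpace.toFun_sub (f g : ZygmundSpace) : (f - g).toFun = f.toFun - g.toFun := rfl

/-! ### The two weights -/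

theorem half_le_log_two : (1 : ℝ) / 2 ≤ Real.log 2 := by linarith [Real.log_two_gt_d9]

/-- The function `x ↦ x log (2 / x)` is increasing on `(0, 1]` up to a constant factor. -/
theorem mul_log_two_div_le {x y : ℝ} (hy : 0 < y) (hyx : y ≤ x) (hx : x ≤ 1) :
    y * Real.log (2 / y) ≤ 3 * (x * Real.log (2 / x)) := by
  have hx0 : 0 < x := hy.trans_le hyx
  have h1 : Real.log (2 / y) = Real.log (2 / x) + Real.log (x / y) := by
    rw [← Real.log_mul (by positivity) (by positivity)]
    congr 1
    field_simp
  have h2 : y * Real.log (x / y) ≤ x := by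
    calc y * Real.log (x / y) ≤ y * (x / y) := by
          gcongr
          exact Real.log_le_self (by positivity)
      _ = x := by field_simp
  have h3 : 1 / 2 ≤ Real.log (2 / x) := half_le_log_two.trans
    (Real.log_le_log two_pos (by rw [le_div_iff₀ hx0]; linarith))
  rw [h1, mul_add]
  nlinarith

theorem mul_log_two_div_le_div_mul {x y : ℝ} (hx : 0 < x) (hxy : x ≤ y) :
    y * Real.log (2 / y) ≤ y / x * (x * Real.log (2 / x)) := by
  have hy : 0 < y := hx.trans_le hxy
  rw [← mul_assoc, div_mul_cancel₀ _ hx.ne']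
  gcongr

/-- `log (log (4 / (1 - r²)))`, the reciprocal of `w_log` as a function of the modulus. -/
noncomputable def logLog (r : ℝ) : ℝ := Real.log (Real.log (4 / (1 - r ^ 2)))

theorem wLog_eq (z : 𝔻) : wLog z = (logLog ‖(z : ℂ)‖)⁻¹ := rfl

section LogLog

variable {r s : ℝ}

theorem one_sub_sq_pos (h0 : 0 ≤ r) (h1 : r < 1) : 0 < 1 - r ^ 2 := by nlinarith

theorem log_four_gt : (1.38 : ℝ) < Real.log 4 := by
  rw [show (4 : ℝ) = 2 ^ 2 by norm_num, Real.log_pow]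
  push_cast
  linarith [Real.log_two_gt_d9]

theorem log_four_le_log_div (h0 : 0 ≤ r) (h1 : r < 1) :
    Real.log 4 ≤ Real.log (4 / (1 - r ^ 2)) := by
  refine Real.log_le_log four_pos ?_
  rw [le_div_iff₀ (one_sub_sq_pos h0 h1)]
  nlinarith

theorem one_le_log_div (h0 : 0 ≤ r) (h1 : r < 1) : 1 ≤ Real.log (4 / (1 - r ^ 2)) := by
  linarith [log_four_le_log_div h0 h1, log_four_gt]

theorem quarter_le_logLog (h0 : 0 ≤ r) (h1 : r < 1) : 1 / 4 ≤ logLog r := by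
  have h2 := (log_four_gt.trans_le (log_four_le_log_div h0 h1)).le
  have h3 := Real.log_le_log (by norm_num) h2
  have h4 := Real.one_sub_inv_le_log_of_pos (show (0 : ℝ) < 1.38 by norm_num)
  have h5 : (1 : ℝ) / 4 ≤ 1 - 1.38⁻¹ := by norm_num
  exact h5.trans (h4.trans h3)

theorem logLog_pos (h0 : 0 ≤ r) (h1 : r < 1) : 0 < logLog r := by
  linarith [quarter_le_logLog h0 h1]

theorem logLog_mono (h0 : 0 ≤ r) (hrs : r ≤ s) (h1 : s < 1) : logLog r ≤ logLog s := by
  have hr := hrs.trans_lt h1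
  have := one_sub_sq_pos (h0.trans hrs) h1
  refine Real.log_le_log (by linarith [one_le_log_div h0 hr]) (Real.log_le_log ?_ ?_)
  · exact div_pos four_pos (one_sub_sq_pos h0 hr)
  · gcongr

/-- With `t = (1 - s) / (1 - r)` the inner logarithms differ by at most `2 t`, and the outer
logarithm is `1`-Lipschitz where the inner one is at least `1`. -/
theorem logLog_le_mul_exp (h0 : 0 ≤ r) (h1 : r < 1) (h0' : 0 ≤ s) (h1' : s < 1) :
    logLog r ≤ 9 * Real.exp ((1 - s) / (1 - r)) * logLog s := by
  have hr := one_sub_sq_pos h0 h1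
  have hs := one_sub_sq_pos h0' h1'
  have hxr : 0 < 1 - r := by linarith
  have hxs : 0 < 1 - s := by linarith
  set t := (1 - s) / (1 - r) with ht
  have ht0 : 0 < t := div_pos hxs hxr
  have hA := one_le_log_div h0' h1'
  set A := Real.log (4 / (1 - s ^ 2)) with hAdef
  have hratio : (1 - s ^ 2) / (1 - r ^ 2) ≤ 2 * t := by
    rw [div_le_iff₀ hr]
    have h2 : (1 - s) * (1 + s) ≤ 2 * t * ((1 - r) * (1 + r)) := by
      have h3 : t * (1 - r) = 1 - s := div_mul_cancel₀ _ hxr.ne'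
      have h4 : 2 * t * ((1 - r) * (1 + r)) = 2 * (1 - s) * (1 + r) := by rw [← h3]; ring
      rw [h4]
      nlinarith
    nlinarith
  have hsplit : Real.log (4 / (1 - r ^ 2)) = A + Real.log ((1 - s ^ 2) / (1 - r ^ 2)) := by
    rw [hAdef, ← Real.log_mul (by positivity) (by positivity)]
    congr 1
    field_simp
  have h5 : Real.log ((1 - s ^ 2) / (1 - r ^ 2)) ≤ 2 * t :=
    (Real.log_le_self (by positivity)).trans hratio
  have h6 : Real.log (4 / (1 - r ^ 2)) ≤ A * (1 + 2 * t) := by nlinarith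
  have h7 : logLog r ≤ logLog s + 2 * t := by
    have h8 := Real.log_le_log (by linarith [one_le_log_div h0 h1]) h6
    rw [Real.log_mul (by positivity) (by positivity)] at h8
    have h9 := Real.log_le_sub_one_of_pos (show 0 < 1 + 2 * t by positivity)
    unfold logLog
    linarith
  have h10 := quarter_le_logLog h0' h1'
  have h11 := Real.add_one_le_exp t
  nlinarith

theorem logLog_two_div_le_logLog (h0 : 0 ≤ r) (h1 : r < 1) :
    Real.log (Real.log (2 / (1 - r))) ≤ logLog r := by
  have hx : 0 < 1 - r := by linarith
  have h2 : 2 ≤ 2 / (1 - r) := by rw [le_div_iff₀ hx]; linarith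
  refine Real.log_le_log (Real.log_pos (by linarith)) (Real.log_le_log (by linarith) ?_)
  rw [div_le_div_iff₀ hx (one_sub_sq_pos h0 h1)]
  nlinarith

theorem tendsto_inv_log_two_div :
    Tendsto (fun r : ℝ => (Real.log (2 / (1 - r)))⁻¹) (𝓝[<] 1) (𝓝 0) := by
  refine tendsto_inv_atTop_zero.comp (Real.tendsto_log_atTop.comp ?_)
  refine Tendsto.const_mul_atTop two_pos (tendsto_inv_nhdsGT_zero.comp ?_)
  refine tendsto_nhdsWithin_iff.2 ⟨?_, ?_⟩
  · exact tendsto_nhdsWithin_of_tendsto_nhds (Continuous.tendsto' (by fun_prop) _ _ (by simp))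
  · filter_upwards [self_mem_nhdsWithin] with r hr
    exact Set.mem_Ioi.2 (sub_pos.2 (Set.mem_Iio.1 hr))

theorem tendsto_inv_logLog : Tendsto (fun r : ℝ => (logLog r)⁻¹) (𝓝[<] 1) (𝓝 0) := by
  refine tendsto_inv_atTop_zero.comp (Real.tendsto_log_atTop.comp (Real.tendsto_log_atTop.comp ?_))
  refine Tendsto.const_mul_atTop four_pos (tendsto_inv_nhdsGT_zero.comp ?_)
  refine tendsto_nhdsWithin_iff.2 ⟨?_, ?_⟩
  · exact tendsto_nhdsWithin_of_tendsto_nhds (Continuous.tendsto' (by fun_prop) _ _ (by simp))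
  · filter_upwards [Ioo_mem_nhdsLT (zero_lt_one' ℝ)] with r hr
    exact one_sub_sq_pos hr.1.le hr.2

end LogLog

theorem wLog_pos (z : 𝔻) : 0 < wLog z :=
  inv_pos.2 (logLog_pos (norm_nonneg _) z.norm_lt_one)

theorem one_sub_norm_pos (z : 𝔻) : 0 < 1 - ‖(z : ℂ)‖ := sub_pos.2 z.norm_lt_one

/-- A radial weight that varies so slowly that the supremum of `w(z) |z| ^ n` is comparable to the
value of `w` on the circle of radius `1 - 1 / n`. -/
def SlowWeight (w : 𝔻 → ℝ) : Prop :=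
  ∃ C > 0, ∀ a b : 𝔻, w b ≤ C * Real.exp ((1 - ‖(b : ℂ)‖) / (1 - ‖(a : ℂ)‖)) * w a

theorem slowWeight_vLog : SlowWeight vLog := by
  refine ⟨3, by norm_num, fun a b => ?_⟩
  have ha := one_sub_norm_pos a
  have hb := one_sub_norm_pos b
  have hva := (vLog_pos a).le
  have he := Real.add_one_le_exp ((1 - ‖(b : ℂ)‖) / (1 - ‖(a : ℂ)‖))
  have ht : 0 < (1 - ‖(b : ℂ)‖) / (1 - ‖(a : ℂ)‖) := div_pos hb ha
  rcases le_total (1 - ‖(b : ℂ)‖) (1 - ‖(a : ℂ)‖) with h | h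
  · have h1 : vLog b ≤ 3 * vLog a := mul_log_two_div_le hb h (by linarith [norm_nonneg (a : ℂ)])
    nlinarith
  · have h1 : vLog b ≤ _ * vLog a := mul_log_two_div_le_div_mul ha h
    nlinarith

theorem slowWeight_wLog : SlowWeight wLog := by
  refine ⟨9, by norm_num, fun a b => ?_⟩
  have ha := logLog_pos (norm_nonneg _) a.norm_lt_one
  have hb := logLog_pos (norm_nonneg _) b.norm_lt_one
  have h := logLog_le_mul_exp (norm_nonneg _) a.norm_lt_one (norm_nonneg _) b.norm_lt_one
  rw [wLog_eq, wLog_eq, inv_eq_one_div, div_le_iff₀ hb, mul_right_comm, ← div_eq_mul_inv,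
    le_div_iff₀ ha, one_mul]
  exact h

theorem vLog_le (z : 𝔻) : vLog z ≤ 3 := by
  have h := mul_log_two_div_le (one_sub_norm_pos z) (by linarith [norm_nonneg (z : ℂ)]) le_rfl
  have h2 := Real.log_two_lt_d9
  rw [div_one, one_mul] at h
  exact h.trans (by linarith)

theorem SlowWeight.bddAbove {w : 𝔻 → ℝ} (hw : SlowWeight w) (hpos : ∀ z, 0 < w z) :
    ∃ K, ∀ z, w z ≤ K := by
  obtain ⟨C, hC, h⟩ := hw
  refine ⟨C * Real.exp 1 * w 0, fun z => (h 0 z).trans ?_⟩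
  have := (hpos 0).le
  gcongr
  simp

theorem SlowWeight.exists_pos_le {w : 𝔻 → ℝ} (hw : SlowWeight w) (hpos : ∀ z, 0 < w z) {r : ℝ}
    (hr : r < 1) : ∃ m > 0, ∀ z : 𝔻, ‖(z : ℂ)‖ ≤ r → m ≤ w z := by
  obtain ⟨C, hC, h⟩ := hw
  have hr' : 0 < 1 - r := by linarith
  refine ⟨w 0 / (C * Real.exp (1 / (1 - r))), div_pos (hpos 0) (by positivity), fun z hz => ?_⟩
  rw [div_le_iff₀' (by positivity)]
  refine (h z 0).trans ?_
  have := (hpos z).le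
  gcongr
  simp

/-! ### Weighted suprema of powers and decay near the boundary -/

/-- `q(z) / w(φ(z)) → 0` as `|φ(z)| → 1`. The condition is void when `|φ|` stays away from `1`. -/
def BoundaryVanishing (φ : 𝔻 → 𝔻) (w q : 𝔻 → ℝ) : Prop :=
  ∀ ε > 0, ∃ r < 1, ∀ z, r < ‖(φ z : ℂ)‖ → q z ≤ ε * w (φ z)

variable {w : 𝔻 → ℝ}

theorem le_powSup (ψ : 𝔻 → 𝔻) (q : 𝔻 → ℝ) (n : ℕ) (z : 𝔻) :
    ENNReal.ofReal (q z * ‖(ψ z : ℂ)‖ ^ n) ≤ powSup ψ q n :=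
  le_iSup (fun z : 𝔻 => ENNReal.ofReal (q z * ‖(ψ z : ℂ)‖ ^ n)) z

theorem powSup_lt_top {ψ : 𝔻 → 𝔻} {q : 𝔻 → ℝ} (hq : ∀ z, 0 ≤ q z) {K : ℝ} (hK : ∀ z, q z ≤ K)
    (n : ℕ) : powSup ψ q n < ∞ :=
  (iSup_le fun z => ENNReal.ofReal_le_ofReal ((mul_le_of_le_one_right (hq z)
    (pow_le_one₀ (norm_nonneg _) (ψ z).norm_lt_one.le)).trans (hK z))).trans_lt
    (ENNReal.ofReal_lt_top (r := K))

/-- A point of the disc with prescribed modulus. -/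
theorem exists_norm_eq {r : ℝ} (h0 : 0 ≤ r) (h1 : r < 1) : ∃ z : 𝔻, ‖(z : ℂ)‖ = r := by
  have h : ‖(r : ℂ)‖ = r := by rw [Complex.norm_real, Real.norm_of_nonneg h0]
  exact ⟨.mk r (h.trans_lt h1), h⟩

theorem powSup_id_ne_zero (hpos : ∀ z, 0 < w z) (n : ℕ) : powSup id w n ≠ 0 := by
  obtain ⟨z, hz⟩ := exists_norm_eq (r := 1 / 2) (by norm_num) (by norm_num)
  refine ((ENNReal.ofReal_pos.2 ?_).trans_le (le_powSup id w n z)).ne'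
  have := hpos z
  simp only [id, hz]
  positivity

/-- With `n = ⌊1 / (1 - |a|)⌋` the power `|a| ^ n` is bounded below. -/
theorem exp_neg_two_le_pow_floor {r : ℝ} (h0 : 1 / 2 ≤ r) (h1 : r < 1) :
    Real.exp (-2) ≤ r ^ ⌊1 / (1 - r)⌋₊ := by
  have hx : 0 < 1 - r := by linarith
  have h2 : Real.exp (-(2 * (1 - r))) ≤ r := by
    rw [Real.exp_neg]
    refine inv_le_of_inv_le₀ (by linarith) (le_trans ?_ (Real.add_one_le_exp _))
    rw [inv_eq_one_div, div_le_iff₀ (by linarith)]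
    nlinarith
  have h3 : (⌊1 / (1 - r)⌋₊ : ℝ) * (1 - r) ≤ 1 := by
    rw [← le_div_iff₀ hx]
    exact Nat.floor_le (by positivity)
  calc Real.exp (-2) ≤ Real.exp (⌊1 / (1 - r)⌋₊ * -(2 * (1 - r))) :=
        Real.exp_le_exp.2 (by linarith)
    _ = Real.exp (-(2 * (1 - r))) ^ ⌊1 / (1 - r)⌋₊ := Real.exp_nat_mul _ _
    _ ≤ _ := pow_le_pow_left₀ (Real.exp_pos _).le h2 _

/-- The exponential loss in `SlowWeight` is compensated by `|b| ^ n ≤ exp (-n (1 - |b|))`. -/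
theorem powSup_id_floor_le {C : ℝ} (hC : 0 < C) (hpos : ∀ z, 0 < w z) {a : 𝔻}
    (h : ∀ b : 𝔻, w b ≤ C * Real.exp ((1 - ‖(b : ℂ)‖) / (1 - ‖(a : ℂ)‖)) * w a) :
    powSup id w ⌊1 / (1 - ‖(a : ℂ)‖)⌋₊ ≤ ENNReal.ofReal (C * Real.exp 1 * w a) := by
  refine iSup_le fun b => ENNReal.ofReal_le_ofReal ?_
  set n := ⌊1 / (1 - ‖(a : ℂ)‖)⌋₊ with hn
  have ha := one_sub_norm_pos a
  have hb := one_sub_norm_pos b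
  have hfl := Nat.lt_floor_add_one (1 / (1 - ‖(a : ℂ)‖))
  rw [← hn] at hfl
  have h2 : ‖(b : ℂ)‖ ^ n ≤ Real.exp (1 - (1 - ‖(b : ℂ)‖) / (1 - ‖(a : ℂ)‖)) := by
    have h3 : ‖(b : ℂ)‖ ≤ Real.exp (-(1 - ‖(b : ℂ)‖)) := by
      linarith [Real.add_one_le_exp (-(1 - ‖(b : ℂ)‖))]
    refine (pow_le_pow_left₀ (norm_nonneg _) h3 n).trans ?_
    rw [← Real.exp_nat_mul, Real.exp_le_exp, ← mul_one_div]
    nlinarith [norm_nonneg (b : ℂ)]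
  have hwa := (hpos a).le
  calc w b * ‖(b : ℂ)‖ ^ n
      ≤ (C * Real.exp ((1 - ‖(b : ℂ)‖) / (1 - ‖(a : ℂ)‖)) * w a) *
          Real.exp (1 - (1 - ‖(b : ℂ)‖) / (1 - ‖(a : ℂ)‖)) :=
        mul_le_mul (h b) h2 (by positivity) (by positivity)
    _ = C * (Real.exp ((1 - ‖(b : ℂ)‖) / (1 - ‖(a : ℂ)‖)) *
          Real.exp (1 - (1 - ‖(b : ℂ)‖) / (1 - ‖(a : ℂ)‖))) * w a := by ring
    _ = _ := by rw [← Real.exp_add, add_sub_cancel]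

/-- The point `z` is tested with the power `n = ⌊1 / (1 - |φ(z)|)⌋`, which tends to infinity as
`|φ(z)| → 1`. -/
theorem boundaryVanishing_of_tendsto {φ : 𝔻 → 𝔻} {q : 𝔻 → ℝ} (hq : ∀ z, 0 ≤ q z)
    (hw : SlowWeight w) (hpos : ∀ z, 0 < w z)
    (h : Tendsto (fun n => powSup φ q n / powSup id w n) atTop (𝓝 0)) :
    BoundaryVanishing φ w q := by
  obtain ⟨K, hK⟩ := hw.bddAbove hpos
  obtain ⟨C, hC, hwC⟩ := hw
  intro ε hε
  have hδ : 0 < ε * Real.exp (-2) / (C * Real.exp 1) := by positivity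
  obtain ⟨N, hN⟩ := eventually_atTop.1
    (h.eventually (gt_mem_nhds (ENNReal.ofReal_pos.2 hδ)))
  refine ⟨max (1 / 2) (1 - 1 / (N + 1)), max_lt (by norm_num) (sub_lt_self _ (by positivity)),
    fun z hz => ?_⟩
  set a := φ z
  have ha := one_sub_norm_pos a
  have h1 := (le_max_left _ _).trans hz.le
  have h2 := (le_max_right _ _).trans hz.le
  have hNn : N ≤ ⌊1 / (1 - ‖(a : ℂ)‖)⌋₊ := by
    refine Nat.le_floor ?_
    have h3 : 1 - ‖(a : ℂ)‖ ≤ 1 / (N + 1) := by linarith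
    rw [le_div_iff₀ ha]
    rw [le_div_iff₀ (by positivity)] at h3
    nlinarith
  have h3 := ENNReal.div_le_iff (powSup_id_ne_zero hpos _)
    (powSup_lt_top (fun z => (hpos z).le) hK _).ne |>.1 (hN _ hNn).le
  have h4 := (le_powSup φ q _ z).trans
    (h3.trans (mul_le_mul_right (powSup_id_floor_le hC hpos (hwC a)) _))
  have hwa := hpos a
  rw [← ENNReal.ofReal_mul hδ.le, ENNReal.ofReal_le_ofReal_iff (by positivity)] at h4
  have h5 : ε * Real.exp (-2) / (C * Real.exp 1) * (C * Real.exp 1 * w a) =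
      ε * w a * Real.exp (-2) := by field_simp
  rw [h5] at h4
  refine le_of_mul_le_mul_right (le_trans ?_ h4) (Real.exp_pos (-2))
  exact mul_le_mul_of_nonneg_left (exp_neg_two_le_pow_floor h1 a.norm_lt_one) (hq z)

/-- Where `|φ| ≤ r` the powers of `φ` decay like `r ^ n`, while `sup_z w(z) |z| ^ n` decays more
slowly than `s ^ n` for each `s < 1`. -/
theorem tendsto_of_boundaryVanishing {φ : 𝔻 → 𝔻} {q : 𝔻 → ℝ} (hq : ∀ z, 0 ≤ q z) {K : ℝ}
    (hK : ∀ z, q z ≤ K) (hw : SlowWeight w) (hpos : ∀ z, 0 < w z)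
    (h : BoundaryVanishing φ w q) :
    Tendsto (fun n => powSup φ q n / powSup id w n) atTop (𝓝 0) := by
  obtain ⟨M, hM⟩ := hw.bddAbove hpos
  have hW : ∀ n, powSup id w n ≠ 0 := powSup_id_ne_zero hpos
  have hW' : ∀ n, powSup id w n ≠ ∞ := fun n => (powSup_lt_top (fun z => (hpos z).le) hM n).ne
  have hK0 : 0 ≤ K := (hq 0).trans (hK 0)
  suffices H : ∀ ε : ℝ, 0 < ε → ∀ᶠ n in atTop,
      powSup φ q n / powSup id w n ≤ ENNReal.ofReal ε by
    rw [ENNReal.tendsto_nhds_zero]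
    intro ε hε
    obtain ⟨δ, hδ0, hδ⟩ := ENNReal.lt_iff_exists_nnreal_btwn.1 hε
    filter_upwards [H δ (by exact_mod_cast hδ0)] with n hn
    exact hn.trans (by rw [ENNReal.ofReal_coe_nnreal]; exact hδ.le)
  intro ε hε
  obtain ⟨r, hr1, hr⟩ := h ε hε
  set s := max r 0 with hs
  have hs0 : 0 ≤ s := le_max_right _ _
  have hs1 : s < 1 := max_lt hr1 one_pos
  obtain ⟨b, hb⟩ := exists_norm_eq (r := (s + 1) / 2) (by linarith) (by linarith)
  have hb0 : 0 < ‖(b : ℂ)‖ := by rw [hb]; linarith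
  have hsb : s / ‖(b : ℂ)‖ < 1 := by rw [div_lt_one hb0, hb]; linarith
  have hlim : Tendsto (fun n : ℕ => K * (s / ‖(b : ℂ)‖) ^ n) atTop (𝓝 0) := by
    simpa using (tendsto_pow_atTop_nhds_zero_of_lt_one (by positivity) hsb).const_mul K
  have hwb := hpos b
  filter_upwards [hlim.eventually (gt_mem_nhds (mul_pos hε hwb))] with n hn
  rw [ENNReal.div_le_iff (hW n) (hW' n)]
  refine iSup_le fun z => ?_
  by_cases hz : r < ‖(φ z : ℂ)‖
  · refine le_trans ?_ (mul_le_mul_right (le_powSup id w n (φ z)) _)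
    rw [← ENNReal.ofReal_mul hε.le]
    refine ENNReal.ofReal_le_ofReal ?_
    rw [← mul_assoc]
    exact mul_le_mul_of_nonneg_right (hr z hz) (by positivity)
  · refine le_trans ?_ (mul_le_mul_right (le_powSup id w n b) _)
    rw [← ENNReal.ofReal_mul hε.le]
    refine ENNReal.ofReal_le_ofReal ?_
    have h1 : ‖(φ z : ℂ)‖ ≤ s := (not_lt.1 hz).trans (le_max_left _ _)
    calc q z * ‖(φ z : ℂ)‖ ^ n ≤ K * s ^ n := by
          gcongr
          exact hK z
      _ = K * (s / ‖(b : ℂ)‖) ^ n * ‖(b : ℂ)‖ ^ n := by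
          rw [div_pow, mul_assoc, div_mul_cancel₀ _ (pow_pos hb0 n).ne']
      _ ≤ ε * w b * ‖(b : ℂ)‖ ^ n := by gcongr
      _ = _ := by simp only [id]; ring

theorem BoundaryVanishing.exists_le_mul {φ : 𝔻 → 𝔻} {q : 𝔻 → ℝ} {K : ℝ} (hK : ∀ z, q z ≤ K)
    (hw : SlowWeight w) (hpos : ∀ z, 0 < w z) (h : BoundaryVanishing φ w q) :
    ∃ K', 0 ≤ K' ∧ ∀ z, q z ≤ K' * w (φ z) := by
  obtain ⟨r, hr1, hr⟩ := h 1 one_pos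
  obtain ⟨m, hm0, hm⟩ := hw.exists_pos_le hpos hr1
  refine ⟨max 1 (K / m), le_max_of_le_left zero_le_one, fun z => ?_⟩
  have hwz := (hpos (φ z)).le
  by_cases hz : r < ‖(φ z : ℂ)‖
  · exact (hr z hz).trans (mul_le_mul_of_nonneg_right (le_max_left _ _) hwz)
  · have h1 := hm (φ z) (not_lt.1 hz)
    rcases le_total K 0 with hK0 | hK0
    · exact (hK z).trans (hK0.trans (mul_nonneg (le_max_of_le_left zero_le_one) hwz))
    · refine (hK z).trans (le_trans ?_ (mul_le_mul_of_nonneg_right (le_max_right _ _) hwz))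
      rw [div_mul_eq_mul_div, le_div_iff₀ hm0]
      gcongr

/-! ### Growth of the derivative -/

theorem norm_ofReal_mul_le {t : ℝ} (ht : t ∈ Set.Icc (0 : ℝ) 1) (z : 𝔻) :
    ‖(t : ℂ) * z‖ = t * ‖(z : ℂ)‖ ∧ t * ‖(z : ℂ)‖ ≤ ‖(z : ℂ)‖ := by
  rw [norm_mul, Complex.norm_real, Real.norm_of_nonneg ht.1]
  exact ⟨rfl, mul_le_of_le_one_left (norm_nonneg _) ht.2⟩

/-- The second derivative is integrated along the radius to `z`: an antiderivative of
`1 / v_log` as a function of the modulus is `log (log (2 / (1 - r)))`. -/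
theorem norm_der_le (f : ZygmundSpace) (z : 𝔻) :
    ‖der f.toFun z‖ ≤ 9 * ‖f‖ * logLog ‖(z : ℂ)‖ := by
  set ρ := ‖(z : ℂ)‖ with hρ
  have hρ0 : 0 ≤ ρ := norm_nonneg _
  have hρ1 : ρ < 1 := z.norm_lt_one
  have hmem : ∀ t ∈ Set.Icc (0 : ℝ) 1, ‖(t : ℂ) * z‖ < 1 := fun t ht =>
    (norm_ofReal_mul_le ht z).1.trans_lt ((norm_ofReal_mul_le ht z).2.trans_lt hρ1)
  have hline : ∀ t : ℝ, HasDerivAt (fun t : ℝ => (t : ℂ) * z) z t := fun t => by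
    simpa using (Complex.ofRealCLM.hasDerivAt (x := t)).mul_const (z : ℂ)
  have hd : ∀ t ∈ Set.Icc (0 : ℝ) 1, HasDerivAt (fun t : ℝ => toPlane (der f.toFun) ((t : ℂ) * z))
      (toPlane (der (der f.toFun)) ((t : ℂ) * z) * z) t := by
    intro t ht
    refine HasDerivAt.comp t ?_ (hline t)
    have h1 := hmem t ht
    lift (t : ℂ) * z to 𝔻 using h1 with w
    rw [toPlane_coe]
    exact f.isHolo.der.hasDerivAt w
  have hpos : ∀ t ∈ Set.Icc (0 : ℝ) 1, 0 < 1 - t * ρ := fun t ht => by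
    linarith [(norm_ofReal_mul_le ht z).2]
  have hlog : ∀ t ∈ Set.Icc (0 : ℝ) 1, 0 < Real.log 2 - Real.log (1 - t * ρ) := fun t ht => by
    have h1 : Real.log (1 - t * ρ) ≤ 0 := Real.log_nonpos (hpos t ht).le (by
      linarith [mul_nonneg ht.1 hρ0])
    linarith [half_le_log_two]
  have hB : ∀ t ∈ Set.Icc (0 : ℝ) 1, HasDerivAt
      (fun t : ℝ => ‖f‖ + ‖f‖ * (Real.log (Real.log 2 - Real.log (1 - t * ρ)) + 1))
      (‖f‖ * (ρ / (1 - t * ρ) / (Real.log 2 - Real.log (1 - t * ρ)))) t := by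
    intro t ht
    have h1 : HasDerivAt (fun t : ℝ => 1 - t * ρ) (-ρ) t := by
      simpa using ((hasDerivAt_id t).mul_const ρ).const_sub 1
    have h2 := (h1.log (hpos t ht).ne').const_sub (Real.log 2)
    have h3 := ((((h2.log (hlog t ht).ne').add_const 1).const_mul ‖f‖).const_add ‖f‖)
    refine h3.congr_deriv ?_
    simp only [neg_div, neg_neg]
  have hbound : ∀ t ∈ Set.Ico (0 : ℝ) 1, ‖toPlane (der (der f.toFun)) ((t : ℂ) * z) * z‖ ≤
      ‖f‖ * (ρ / (1 - t * ρ) / (Real.log 2 - Real.log (1 - t * ρ))) := by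
    intro t ht'
    have ht := Set.Ico_subset_Icc_self ht'
    have h1 := hmem t ht
    have h2 := (norm_ofReal_mul_le ht z).1
    have h3 := hpos t ht
    have h4 := hlog t ht
    lift (t : ℂ) * z to 𝔻 using h1 with w
    have h5 := vLog_mul_norm_le f w
    rw [vLog, h2, ← hρ, Real.log_div two_ne_zero h3.ne'] at h5
    rw [toPlane_coe, norm_mul, ← hρ, div_div, mul_div_assoc', le_div_iff₀ (by positivity)]
    calc ‖der (der f.toFun) w‖ * ρ * ((1 - t * ρ) * (Real.log 2 - Real.log (1 - t * ρ)))
        = (1 - t * ρ) * (Real.log 2 - Real.log (1 - t * ρ)) * ‖der (der f.toFun) w‖ * ρ := by ring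
      _ ≤ ‖f‖ * ρ := by gcongr
  have h0 : ‖toPlane (der f.toFun) (((0 : ℝ) : ℂ) * z)‖ ≤
      ‖f‖ + ‖f‖ * (Real.log (Real.log 2 - Real.log (1 - 0 * ρ)) + 1) := by
    have h1 := norm_der_zero_le f
    have h2 := Real.one_sub_inv_le_log_of_pos (Real.log_pos one_lt_two)
    have h3 : (Real.log 2)⁻¹ ≤ 2 := by
      rw [inv_le_comm₀ (Real.log_pos one_lt_two) two_pos, inv_eq_one_div]
      exact half_le_log_two
    have h4 : toPlane (der f.toFun) (((0 : ℝ) : ℂ) * z) = der f.toFun 0 := by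
      rw [Complex.ofReal_zero, zero_mul, ← Complex.UnitDisc.coe_zero, toPlane_coe]
    rw [h4, zero_mul, sub_zero, Real.log_one, sub_zero]
    nlinarith [norm_nonneg f]
  have key := image_norm_le_of_norm_deriv_right_le_deriv_boundary'
    (fun t ht => (hd t ht).continuousAt.continuousWithinAt)
    (fun t ht => (hd t (Set.Ico_subset_Icc_self ht)).hasDerivWithinAt) h0
    (fun t ht => (hB t ht).continuousAt.continuousWithinAt)
    (fun t ht => (hB t (Set.Ico_subset_Icc_self ht)).hasDerivWithinAt) hbound
    (Set.right_mem_Icc.2 (zero_le_one' ℝ))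
  rw [Complex.ofReal_one, one_mul, one_mul, toPlane_coe] at key
  have h5 := logLog_two_div_le_logLog hρ0 hρ1
  rw [Real.log_div two_ne_zero (by linarith)] at h5
  have h6 := quarter_le_logLog hρ0 hρ1
  refine key.trans ?_
  nlinarith [norm_nonneg f]

theorem norm_sub_le_mul {f : 𝔻 → ℂ} (hf : IsHolo f) {r M : ℝ} (hr : r < 1)
    (hM : ∀ z : 𝔻, ‖(z : ℂ)‖ ≤ r → ‖der f z‖ ≤ M) {z w : 𝔻} (hz : ‖(z : ℂ)‖ ≤ r)
    (hw : ‖(w : ℂ)‖ ≤ r) : ‖f z - f w‖ ≤ M * ‖(z : ℂ) - w‖ := by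
  have h := (convex_closedBall (0 : ℂ) r).norm_image_sub_le_of_norm_deriv_le (𝕜 := ℂ)
    (f := toPlane f) (C := M) (x := w) (y := z) (fun x hx => ?_) (fun x hx => ?_)
    (mem_closedBall_zero_iff.2 hw) (mem_closedBall_zero_iff.2 hz)
  · rwa [toPlane_coe, toPlane_coe] at h
  · have hx' := mem_closedBall_zero_iff.1 hx
    lift x to 𝔻 using hx'.trans_lt hr
    exact hf.differentiableAt x
  · have hx' := mem_closedBall_zero_iff.1 hx
    lift x to 𝔻 using hx'.trans_lt hr
    exact hM x hx'

theorem norm_der_le_of_norm_le (f : ZygmundSpace) {r : ℝ} (hr : r < 1) {z : 𝔻}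
    (hz : ‖(z : ℂ)‖ ≤ r) : ‖der f.toFun z‖ ≤ 9 * ‖f‖ * logLog r := by
  refine (norm_der_le f z).trans ?_
  gcongr
  exact logLog_mono (norm_nonneg _) hz hr

theorem norm_apply_le (f : ZygmundSpace) (z : 𝔻) :
    ‖f z‖ ≤ ‖f‖ + 9 * ‖f‖ * logLog ‖(z : ℂ)‖ := by
  have h := norm_sub_le_mul f.isHolo z.norm_lt_one (fun w hw =>
    norm_der_le_of_norm_le f z.norm_lt_one hw) le_rfl
    (show ‖((0 : 𝔻) : ℂ)‖ ≤ ‖(z : ℂ)‖ by simp)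
  have h2 : f z = f 0 + (f z - f 0) := by ring
  have h3 := logLog_pos (norm_nonneg _) z.norm_lt_one
  rw [h2]
  refine (norm_add_le _ _).trans (add_le_add (norm_apply_zero_le f) (h.trans ?_))
  refine mul_le_of_le_one_right (by positivity) ?_
  simpa using z.norm_lt_one.le

/-! ### Locally uniform convergence and normal families -/

/-- Locally uniform convergence on the disc. -/
def TendstoLocUnif {ι : Type*} (F : ι → 𝔻 → ℂ) (g : 𝔻 → ℂ) (l : Filter ι) : Prop :=
  TendstoLocallyUniformlyOn (fun i => toPlane (F i)) (toPlane g) l (Metric.ball 0 1)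

section LocUnif

variable {ι : Type*} {F : ι → 𝔻 → ℂ} {g : 𝔻 → ℂ} {l : Filter ι}

theorem TendstoLocUnif.eventually (h : TendstoLocUnif F g l) {r : ℝ} (hr : r < 1) {ε : ℝ}
    (hε : 0 < ε) : ∀ᶠ i in l, ∀ z : 𝔻, ‖(z : ℂ)‖ ≤ r → ‖F i z - g z‖ < ε := by
  have h1 := (tendstoLocallyUniformlyOn_iff_forall_isCompact Metric.isOpen_ball).1 h _
    (Metric.closedBall_subset_ball hr) (isCompact_closedBall (0 : ℂ) r)
  filter_upwards [Metric.tendstoUniformlyOn_iff.1 h1 ε hε] with i hi z hz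
  have h2 := hi z (mem_closedBall_zero_iff.2 hz)
  rwa [toPlane_coe, toPlane_coe, dist_comm, dist_eq_norm] at h2

theorem TendstoLocUnif.tendsto (h : TendstoLocUnif F g l) (z : 𝔻) :
    Tendsto (fun i => F i z) l (𝓝 (g z)) := by
  simpa only [toPlane_coe] using TendstoLocallyUniformlyOn.tendsto_at h (coe_mem_ball z)

theorem TendstoLocUnif.isHolo [l.NeBot] (h : TendstoLocUnif F g l) (hF : ∀ i, IsHolo (F i)) :
    IsHolo g :=
  TendstoLocallyUniformlyOn.differentiableOn h (Eventually.of_forall hF) Metric.isOpen_ball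

theorem TendstoLocUnif.der (h : TendstoLocUnif F g l) (hF : ∀ i, IsHolo (F i)) :
    TendstoLocUnif (fun i => der (F i)) (der g) l := by
  have h1 := TendstoLocallyUniformlyOn.deriv h (Eventually.of_forall hF) Metric.isOpen_ball
  exact (h1.congr fun i => (toPlane_der_eqOn (F i)).symm).congr_right
    (toPlane_der_eqOn g).symm

/-- Pointwise convergence of a family that is Lipschitz on each smaller disc is locally uniform. -/
theorem tendstoLocUnif_of_tendsto [l.NeBot] (hF : ∀ i, IsHolo (F i))
    (hM : ∀ r < 1, ∃ M, ∀ i, ∀ z : 𝔻, ‖(z : ℂ)‖ ≤ r → ‖der (F i) z‖ ≤ M)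
    (h : ∀ z, Tendsto (fun i => F i z) l (𝓝 (g z))) : TendstoLocUnif F g l := by
  refine Metric.tendstoLocallyUniformlyOn_iff.2 fun ε hε x hx => ?_
  lift x to 𝔻 using mem_ball_zero_iff.1 hx
  obtain ⟨r, hxr, hr⟩ := exists_between x.norm_lt_one
  obtain ⟨M, hM⟩ := hM r hr
  have hM1 : 0 < |M| + 1 := by positivity
  have hlip : ∀ i, ∀ z : 𝔻, ‖(z : ℂ)‖ ≤ r → ‖F i z - F i x‖ ≤ (|M| + 1) * ‖(z : ℂ) - x‖ :=
    fun i z hz => (norm_sub_le_mul (hF i) hr (hM i) hz hxr.le).trans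
      (mul_le_mul_of_nonneg_right ((le_abs_self M).trans (by linarith)) (norm_nonneg _))
  have hlip' : ∀ z : 𝔻, ‖(z : ℂ)‖ ≤ r → ‖g z - g x‖ ≤ (|M| + 1) * ‖(z : ℂ) - x‖ := fun z hz =>
    le_of_tendsto ((h z).sub (h x)).norm (Eventually.of_forall fun i => hlip i z hz)
  refine ⟨Metric.ball x (ε / (3 * (|M| + 1))) ∩ {z | ‖z‖ < r}, mem_nhdsWithin_of_mem_nhds
    (inter_mem (Metric.ball_mem_nhds _ (by positivity))
      ((isOpen_lt continuous_norm continuous_const).mem_nhds hxr)), ?_⟩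
  filter_upwards [Metric.tendsto_nhds.1 (h x) (ε / 3) (by positivity)] with i hi z hz
  have hzr : ‖z‖ < r := hz.2
  have hz1 := hz.1
  lift z to 𝔻 using hzr.trans hr
  rw [Metric.mem_ball, dist_eq_norm, lt_div_iff₀ (by positivity)] at hz1
  rw [dist_eq_norm] at hi
  rw [toPlane_coe, toPlane_coe, dist_eq_norm]
  have h1 := hlip i z hzr.le
  have h2 := hlip' z hzr.le
  have h3 : g z - F i z = (g z - g x) - (F i x - g x) - (F i z - F i x) := by ring
  rw [h3]
  have h4 := norm_sub_le ((g z - g x) - (F i x - g x)) (F i z - F i x)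
  have h5 := norm_sub_le (g z - g x) (F i x - g x)
  nlinarith

/-- Montel's theorem in terms of ultrafilters: a bounded family in `Z^{v_log}` is a normal
family, and its limits lie in the same ball. -/
theorem exists_tendstoLocUnif {G : ι → ZygmundSpace} {M : ℝ} (hG : ∀ i, ‖G i‖ ≤ M)
    (U : Ultrafilter ι) :
    ∃ g : ZygmundSpace, ‖g‖ ≤ M ∧ TendstoLocUnif (fun i => (G i).toFun) g.toFun U := by
  have hlim : ∀ z, ∃ c : ℂ, Tendsto (fun i => G i z) U (𝓝 c) := by
    intro z
    have hmem : ∀ i, G i z ∈ Metric.closedBall (0 : ℂ) (M + 9 * M * logLog ‖(z : ℂ)‖) := by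
      intro i
      rw [mem_closedBall_zero_iff]
      refine (norm_apply_le (G i) z).trans ?_
      have := (logLog_pos (norm_nonneg _) z.norm_lt_one).le
      gcongr <;> exact hG i
    obtain ⟨c, -, hc⟩ := (isCompact_closedBall (0 : ℂ) _).ultrafilter_le_nhds
      (U.map fun i => G i z) (by
        rw [le_principal_iff]
        exact Filter.mem_map.2 (Eventually.of_forall hmem))
    exact ⟨c, hc⟩
  choose g hg using hlim
  have hF : ∀ i, IsHolo (G i).toFun := fun i => (G i).isHolo
  have hunif : TendstoLocUnif (fun i => (G i).toFun) g U := by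
    refine tendstoLocUnif_of_tendsto hF
      (fun r hr => ⟨9 * M * logLog (max r 0), fun i z hz => ?_⟩) hg
    have hr' : max r 0 < 1 := max_lt hr one_pos
    refine (norm_der_le_of_norm_le (G i) hr' (hz.trans (le_max_left _ _))).trans ?_
    have := (logLog_pos (le_max_right r 0) hr').le
    gcongr
    exact hG i
  have hholo := hunif.isHolo hF
  have hbound : ∀ z, ‖g 0‖ + ‖der g 0‖ + vLog z * ‖der (der g) z‖ ≤ M := by
    intro z
    have h1 := (hunif.tendsto 0).norm
    have h2 := ((hunif.der hF).tendsto 0).norm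
    have h3 := ((((hunif.der hF).der fun i => (hF i).der).tendsto z).norm).const_mul (vLog z)
    exact le_of_tendsto ((h1.add h2).add h3)
      (Eventually.of_forall fun i => (norm_add_norm_add_le (G i) z).trans (hG i))
  exact ⟨.ofBound g hholo M hbound, norm_le_of_forall hbound, hunif⟩

end LocUnif

/-! ### The decay conditions imply compactness -/

section Sufficiency

variable {φ : 𝔻 → 𝔻}

theorem vLog_mul_norm_der_der_comp_le (hφ : IsHolo (fun z => (φ z : ℂ))) {f : 𝔻 → ℂ}
    (hf : IsHolo f) (z : 𝔻) :
    vLog z * ‖der (der (fun z => f (φ z))) z‖ ≤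
      vLog z * ‖der (fun z => (φ z : ℂ)) z‖ ^ 2 * ‖der (der f) (φ z)‖ +
      vLog z * ‖der (der (fun z => (φ z : ℂ))) z‖ * ‖der f (φ z)‖ := by
  rw [der_der_comp hf hφ]
  have hv := (vLog_pos z).le
  refine (mul_le_mul_of_nonneg_left (norm_add_le _ _) hv).trans (le_of_eq ?_)
  rw [norm_mul, norm_mul, norm_pow]
  ring

/-- Pointwise control of `C_φ f` by the ratios `q₁ / v_log ∘ φ` and `q₂ / w_log ∘ φ`, where
`q₁ = v_log |φ'|²` and `q₂ = v_log |φ''|`. -/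
theorem vLog_mul_norm_le_of_le (hφ : IsHolo (fun z => (φ z : ℂ))) (f : ZygmundSpace) {z : 𝔻}
    {A B : ℝ} (hA : 0 ≤ A) (hB : 0 ≤ B)
    (h1 : vLog z * ‖der (fun z => (φ z : ℂ)) z‖ ^ 2 ≤ A * vLog (φ z))
    (h2 : vLog z * ‖der (der (fun z => (φ z : ℂ))) z‖ ≤ B * wLog (φ z)) :
    vLog z * ‖der (der (fun z => f (φ z))) z‖ ≤ (A + 9 * B) * ‖f‖ := by
  refine (vLog_mul_norm_der_der_comp_le hφ f.isHolo z).trans ?_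
  have hl := logLog_pos (norm_nonneg _) (φ z).norm_lt_one
  have hw := (wLog_pos (φ z)).le
  calc _ ≤ A * vLog (φ z) * ‖der (der f.toFun) (φ z)‖ +
        B * wLog (φ z) * (9 * ‖f‖ * logLog ‖(φ z : ℂ)‖) :=
        add_le_add (mul_le_mul_of_nonneg_right h1 (norm_nonneg _))
          (mul_le_mul h2 (norm_der_le f (φ z)) (norm_nonneg _) (by positivity))
    _ = A * (vLog (φ z) * ‖der (der f.toFun) (φ z)‖) + 9 * B * ‖f‖ := by
        rw [wLog_eq]
        field_simp
    _ ≤ A * ‖f‖ + 9 * B * ‖f‖ := by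
        gcongr
        exact vLog_mul_norm_le f (φ z)
    _ = _ := by ring

/-- The composition operator as a linear map, given that it preserves `Z^{v_log}`. -/
def compLinear (φ : 𝔻 → 𝔻)
    (h : ∀ f : ZygmundSpace, (fun z => f (φ z)) ∈ zygmundSubmodule) :
    ZygmundSpace →ₗ[ℂ] ZygmundSpace where
  toFun f := ⟨fun z => f (φ z), h f⟩
  map_add' _ _ := rfl
  map_smul' _ _ := rfl

theorem compLinear_toFun (h : ∀ f : ZygmundSpace, (fun z => f (φ z)) ∈ zygmundSubmodule)
    (f : ZygmundSpace) : (compLinear φ h f).toFun = fun z => f (φ z) := rfl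

theorem comp_mem_zygmundSubmodule (hφ : IsHolo (fun z => (φ z : ℂ))) {K₁ K₂ : ℝ}
    (hK₁ : ∀ z, vLog z * ‖der (fun z => (φ z : ℂ)) z‖ ^ 2 ≤ K₁)
    (hK₂ : ∀ z, vLog z * ‖der (der (fun z => (φ z : ℂ))) z‖ ≤ K₂)
    (h₁ : BoundaryVanishing φ vLog (fun z => vLog z * ‖der (fun z => (φ z : ℂ)) z‖ ^ 2))
    (h₂ : BoundaryVanishing φ wLog (fun z => vLog z * ‖der (der (fun z => (φ z : ℂ))) z‖))
    (f : ZygmundSpace) : (fun z => f (φ z)) ∈ zygmundSubmodule := by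
  obtain ⟨A, hA0, hA⟩ := h₁.exists_le_mul hK₁ slowWeight_vLog vLog_pos
  obtain ⟨B, hB0, hB⟩ := h₂.exists_le_mul hK₂ slowWeight_wLog wLog_pos
  refine ⟨f.isHolo.comp hφ, (zygENorm_vLog_le (C := ‖f (φ 0)‖ +
    ‖der (fun z => f (φ z)) 0‖ + (A + 9 * B) * ‖f‖) fun z => ?_).trans_lt ENNReal.ofReal_lt_top⟩
  exact add_le_add le_rfl (vLog_mul_norm_le_of_le hφ f hA0 hB0 (hA z) (hB z))

/-- Near the boundary the decay conditions make `C_φ f` uniformly small, elsewhere locally uniform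
convergence does. -/
theorem tendsto_norm_compLinear {ι : Type*} {l : Filter ι} (hφ : IsHolo (fun z => (φ z : ℂ)))
    {K₁ K₂ : ℝ} (hK₁ : ∀ z, vLog z * ‖der (fun z => (φ z : ℂ)) z‖ ^ 2 ≤ K₁)
    (hK₂ : ∀ z, vLog z * ‖der (der (fun z => (φ z : ℂ))) z‖ ≤ K₂)
    (h₁ : BoundaryVanishing φ vLog (fun z => vLog z * ‖der (fun z => (φ z : ℂ)) z‖ ^ 2))
    (h₂ : BoundaryVanishing φ wLog (fun z => vLog z * ‖der (der (fun z => (φ z : ℂ))) z‖))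
    (hmem : ∀ f : ZygmundSpace, (fun z => f (φ z)) ∈ zygmundSubmodule)
    {G : ι → ZygmundSpace} {M : ℝ} (hG : ∀ i, ‖G i‖ ≤ M)
    (h : TendstoLocUnif (fun i => (G i).toFun) 0 l) :
    Tendsto (fun i => ‖compLinear φ hmem (G i)‖) l (𝓝 0) := by
  rcases l.eq_or_neBot with rfl | hl
  · exact tendsto_bot
  obtain ⟨i₀⟩ := l.nonempty_of_neBot
  have hM : 0 ≤ M := (norm_nonneg _).trans (hG i₀)
  have hK₁0 : 0 ≤ K₁ := le_trans (by have := (vLog_pos 0).le; positivity) (hK₁ 0)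
  have hK₂0 : 0 ≤ K₂ := le_trans (by have := (vLog_pos 0).le; positivity) (hK₂ 0)
  have hF : ∀ i, IsHolo (G i).toFun := fun i => (G i).isHolo
  have hd := h.der hF
  have hdd := hd.der fun i => (hF i).der
  have hd0 : der (0 : 𝔻 → ℂ) = 0 := by simpa using der_smul 0 isHolo_zero
  rw [hd0] at hd
  rw [hd0, hd0] at hdd
  set D := ‖der (fun z => (φ z : ℂ)) 0‖ with hD
  have hD0 : 0 ≤ D := norm_nonneg _
  rw [Metric.tendsto_nhds]
  intro ε hε
  set ε' := ε / (20 * (M + 1)) with hε'def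
  have hε' : 0 < ε' := by positivity
  obtain ⟨r₁, hr₁, hv₁⟩ := h₁ ε' hε'
  obtain ⟨r₂, hr₂, hv₂⟩ := h₂ ε' hε'
  set r := max (max r₁ r₂) ‖(φ 0 : ℂ)‖ with hrdef
  have hr : r < 1 := max_lt (max_lt hr₁ hr₂) (φ 0).norm_lt_one
  set δ := ε / (4 * (1 + D + K₁ + K₂)) with hδdef
  have hδ : 0 < δ := by positivity
  filter_upwards [h.eventually hr hδ, hd.eventually hr hδ, hdd.eventually hr hδ] with i hi hi' hi''
  simp only [Pi.zero_apply, sub_zero] at hi hi' hi''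
  have hnorm : ‖compLinear φ hmem (G i)‖ ≤
      δ + δ * D + (10 * ε' * M + (K₁ * δ + K₂ * δ)) := by
    refine norm_le_of_forall fun z => ?_
    have h0 := le_max_right (max r₁ r₂) ‖(φ 0 : ℂ)‖
    rw [compLinear_toFun]
    refine add_le_add (add_le_add (hi (φ 0) h0).le ?_) ?_
    · rw [der_comp (hF i) hφ, norm_mul]
      exact mul_le_mul_of_nonneg_right (hi' (φ 0) h0).le hD0
    · by_cases hz : r < ‖(φ z : ℂ)‖
      · have hz' := (le_max_left (max r₁ r₂) _).trans_lt hz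
        have h3 := vLog_mul_norm_le_of_le hφ (G i) hε'.le hε'.le
          (hv₁ z ((le_max_left _ _).trans_lt hz')) (hv₂ z ((le_max_right _ _).trans_lt hz'))
        have h4 : (ε' + 9 * ε') * ‖G i‖ ≤ 10 * ε' * M := by
          rw [show ε' + 9 * ε' = 10 * ε' by ring]
          gcongr
          exact hG i
        have : 0 ≤ K₁ * δ + K₂ * δ := by positivity
        linarith
      · have hz' := not_lt.1 hz
        have h3 := vLog_mul_norm_der_der_comp_le hφ (hF i) z
        have h4 := mul_le_mul (hK₁ z) (hi'' (φ z) hz').le (norm_nonneg _) hK₁0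
        have h5 := mul_le_mul (hK₂ z) (hi' (φ z) hz').le (norm_nonneg _) hK₂0
        have : 0 ≤ 10 * ε' * M := by positivity
        linarith
  rw [Real.dist_eq, sub_zero, abs_of_nonneg (norm_nonneg _)]
  refine hnorm.trans_lt ?_
  have e1 : δ * (1 + D + K₁ + K₂) = ε / 4 := by rw [hδdef]; field_simp
  have e2 : 10 * ε' * (M + 1) = ε / 2 := by rw [hε'def]; field_simp; norm_num
  nlinarith

theorem isCompactComposition_of_boundaryVanishing (hφ : IsHolo (fun z => (φ z : ℂ)))
    {K₁ K₂ : ℝ} (hK₁ : ∀ z, vLog z * ‖der (fun z => (φ z : ℂ)) z‖ ^ 2 ≤ K₁)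
    (hK₂ : ∀ z, vLog z * ‖der (der (fun z => (φ z : ℂ))) z‖ ≤ K₂)
    (h₁ : BoundaryVanishing φ vLog (fun z => vLog z * ‖der (fun z => (φ z : ℂ)) z‖ ^ 2))
    (h₂ : BoundaryVanishing φ wLog (fun z => vLog z * ‖der (der (fun z => (φ z : ℂ))) z‖)) :
    IsCompactComposition φ := by
  have hmem := comp_mem_zygmundSubmodule hφ hK₁ hK₂ h₁ h₂
  set T := compLinear φ hmem with hT
  suffices hcomp : IsCompactOperator T from
    ⟨ContinuousLinearMap.mkOfIsCompactOperator hcomp, fun f z => rfl, hcomp⟩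
  refine ⟨T '' Metric.closedBall 0 1, ?_, mem_of_superset (Metric.closedBall_mem_nhds 0 one_pos)
    (Set.subset_preimage_image _ _)⟩
  rw [isCompact_iff_ultrafilter_le_nhds]
  intro V hV
  -- A preimage in the unit ball is chosen for each point of the image, which moves the ultrafilter
  -- to the unit ball.
  have hsel : ∀ y, ∃ f : ZygmundSpace, ‖f‖ ≤ 1 ∧
      (y ∈ T '' Metric.closedBall 0 1 → T f = y) := by
    intro y
    by_cases hy : y ∈ T '' Metric.closedBall 0 1
    · obtain ⟨f, hf, rfl⟩ := hy
      exact ⟨f, mem_closedBall_zero_iff.1 hf, fun _ => rfl⟩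
    · exact ⟨0, by simp, fun h => absurd h hy⟩
  choose G hG hGT using hsel
  obtain ⟨g, hg, hunif⟩ := exists_tendstoLocUnif hG V
  refine ⟨T g, Set.mem_image_of_mem T (mem_closedBall_zero_iff.2 hg), ?_⟩
  have hbound : ∀ y, ‖G y - g‖ ≤ 2 := fun y =>
    (norm_sub_le _ _).trans (by linarith [hG y])
  have hunif0 : TendstoLocUnif (fun y => (G y - g).toFun) 0 V := by
    refine tendstoLocUnif_of_tendsto (fun y => (G y - g).isHolo)
      (fun r hr => ⟨9 * 2 * logLog (max r 0), fun y z hz => ?_⟩) fun z => ?_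
    · have hr' : max r 0 < 1 := max_lt hr one_pos
      refine (norm_der_le_of_norm_le _ hr' (hz.trans (le_max_left _ _))).trans ?_
      have := (logLog_pos (le_max_right r 0) hr').le
      gcongr
      exact hbound y
    · have := (hunif.tendsto z).sub_const (g z)
      rwa [sub_self] at this
  have hlim := tendsto_norm_compLinear hφ hK₁ hK₂ h₁ h₂ hmem hbound hunif0
  have hlim' : Tendsto (fun y => T (G y)) V (𝓝 (T g)) := by
    rw [tendsto_iff_norm_sub_tendsto_zero]
    simpa only [map_sub] using hlim
  have heq : (fun y => T (G y)) =ᶠ[V] id := by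
    filter_upwards [le_principal_iff.1 hV] with y hy using hGT y hy
  exact hlim'.congr' heq

end Sufficiency

/-! ### Compactness applied to families tending to zero -/

section Necessity

theorem tendsto_of_tendsto_norm {ι : Type*} {l : Filter ι} {G : ι → ZygmundSpace}
    {g : ZygmundSpace} (h : Tendsto G l (𝓝 g)) :
    Tendsto (fun i => G i 0) l (𝓝 (g 0)) ∧
      Tendsto (fun i => der (G i).toFun 0) l (𝓝 (der g.toFun 0)) ∧
      ∀ z, Tendsto (fun i => der (der (G i).toFun) z) l (𝓝 (der (der g.toFun) z)) := by
  have h0 := tendsto_iff_norm_sub_tendsto_zero.1 h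
  have hd : ∀ i, der (G i - g).toFun = der (G i).toFun - der g.toFun := fun i => by
    rw [ZygmundSpace.toFun_sub, der_sub (G i).isHolo g.isHolo]
  have hdd : ∀ i, der (der (G i - g).toFun) = der (der (G i).toFun) - der (der g.toFun) :=
    fun i => by rw [hd, der_sub (G i).isHolo.der g.isHolo.der]
  refine ⟨?_, ?_, fun z => ?_⟩
  · exact tendsto_iff_norm_sub_tendsto_zero.2 (squeeze_zero (fun _ => norm_nonneg _)
      (fun i => norm_apply_zero_le (G i - g)) h0)
  · refine tendsto_iff_norm_sub_tendsto_zero.2 (squeeze_zero (fun _ => norm_nonneg _)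
      (fun i => ?_) h0)
    have := norm_der_zero_le (G i - g)
    rwa [hd] at this
  · have h1 : Tendsto (fun i => ‖G i - g‖ / vLog z) l (𝓝 0) := by
      simpa using h0.div_const (vLog z)
    refine tendsto_iff_norm_sub_tendsto_zero.2 (squeeze_zero (fun _ => norm_nonneg _)
      (fun i => ?_) h1)
    have := vLog_mul_norm_le (G i - g) z
    rw [hdd] at this
    rwa [le_div_iff₀' (vLog_pos z)]

variable {φ : 𝔻 → 𝔻} {T : ZygmundSpace →L[ℂ] ZygmundSpace}

/-- Each limit point of the images is zero, since it vanishes pointwise. -/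
theorem tendsto_norm_of_isCompactOperator (hφ : IsHolo (fun z => (φ z : ℂ)))
    (hT : ∀ (f : ZygmundSpace) (z : 𝔻), T f z = f (φ z)) (hc : IsCompactOperator T)
    {ι : Type*} {l : Filter ι} {G : ι → ZygmundSpace} {M : ℝ} (hG : ∀ i, ‖G i‖ ≤ M)
    (h0 : ∀ z, Tendsto (fun i => G i z) l (𝓝 0))
    (h : TendstoLocUnif (fun i => der (G i).toFun) 0 l) :
    Tendsto (fun i => ‖T (G i)‖) l (𝓝 0) := by
  have hTf : ∀ f : ZygmundSpace, (T f).toFun = fun z => f (φ z) := fun f => funext (hT f)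
  have hdd := h.der fun i => (G i).isHolo.der
  have hd0 : der (0 : 𝔻 → ℂ) = 0 := by simpa using der_smul 0 isHolo_zero
  rw [hd0] at hdd
  rw [tendsto_iff_ultrafilter]
  intro U hU
  obtain ⟨K, hK, hTK⟩ := IsCompactOperator.image_closedBall_subset_compact
    (f := T.toLinearMap) hc M
  obtain ⟨g, -, hg⟩ := hK.ultrafilter_le_nhds (U.map fun i => T (G i)) (by
    rw [le_principal_iff]
    exact Filter.mem_map.2 (Eventually.of_forall fun i =>
      hTK (Set.mem_image_of_mem _ (mem_closedBall_zero_iff.2 (hG i)))))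
  have hg' : Tendsto (fun i => T (G i)) U (𝓝 g) := hg
  obtain ⟨e0, e1, e2⟩ := tendsto_of_tendsto_norm hg'
  have f0 : g 0 = 0 := tendsto_nhds_unique e0 (by
    simp only [hT]
    exact (h0 _).mono_left hU)
  have hder : ∀ z, Tendsto (fun i => der (G i).toFun z) U (𝓝 0) := fun z =>
    (h.tendsto z).mono_left hU
  have hder2 : ∀ z, Tendsto (fun i => der (der (G i).toFun) z) U (𝓝 0) := fun z =>
    (hdd.tendsto z).mono_left hU
  have f1 : der g.toFun 0 = 0 := tendsto_nhds_unique e1 (by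
    simp only [hTf, der_comp (G _).isHolo hφ]
    simpa using (hder (φ 0)).mul_const (der (fun z => (φ z : ℂ)) 0))
  have f2 : ∀ z, der (der g.toFun) z = 0 := fun z => tendsto_nhds_unique (e2 z) (by
    simp only [hTf, der_der_comp (G _).isHolo hφ]
    simpa using ((hder2 (φ z)).mul_const (der (fun z => (φ z : ℂ)) z ^ 2)).add
      ((hder (φ z)).mul_const (der (der (fun z => (φ z : ℂ))) z)))
  have hg0 : g = 0 := norm_le_zero_iff.1 (norm_le_of_forall fun z => by simp [f0, f1, f2])
  rw [hg0] at hg'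
  simpa using hg'.norm

/-- A family `H a`, indexed by points `a` of the disc and tending to zero as `|a| → 1`, serves as
the family of derivatives of test functions, each of which is evaluated at `a = φ(z)`. -/
theorem exists_forall_le_of_isCompactOperator (hφ : IsHolo (fun z => (φ z : ℂ)))
    (hT : ∀ (f : ZygmundSpace) (z : 𝔻), T f z = f (φ z)) (hc : IsCompactOperator T)
    {H : 𝔻 → 𝔻 → ℂ} {d : ℝ → ℝ} {M B : ℝ} (hH : ∀ a, IsHolo (H a))
    (hHd : ∀ a z, vLog z * ‖der (H a) z‖ ≤ M) (hB : ∀ a : 𝔻, |d ‖(a : ℂ)‖| ≤ B)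
    (hd : Tendsto d (𝓝[<] 1) (𝓝 0))
    (hHb : ∀ r < 1, ∃ D, ∀ a z : 𝔻, ‖(z : ℂ)‖ ≤ r → ‖H a z‖ ≤ D * d ‖(a : ℂ)‖)
    {ε : ℝ} (hε : 0 < ε) :
    ∃ r < 1, ∀ z, r < ‖(φ z : ℂ)‖ →
      vLog z * ‖der (H (φ z)) (φ z) * der (fun z => (φ z : ℂ)) z ^ 2 +
        H (φ z) (φ z) * der (der (fun z => (φ z : ℂ))) z‖ ≤ ε := by
  obtain ⟨D₀, hD₀⟩ := hHb 0 one_pos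
  have hbound : ∀ a z, ‖primitive (H a) 0‖ + ‖der (primitive (H a)) 0‖ +
      vLog z * ‖der (der (primitive (H a))) z‖ ≤ |D₀| * B + M := by
    intro a z
    rw [primitive_zero, norm_zero, zero_add, der_primitive (hH a)]
    refine add_le_add ((hD₀ a 0 (by simp)).trans ?_) (hHd a z)
    refine (le_abs_self _).trans ?_
    rw [abs_mul]
    exact mul_le_mul_of_nonneg_left (hB a) (abs_nonneg _)
  set G : 𝔻 → ZygmundSpace := fun z =>
    .ofBound (primitive (H (φ z))) (hH _).primitive (|D₀| * B + M) (hbound (φ z)) with hGdef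
  have hGt : ∀ z, (G z).toFun = primitive (H (φ z)) := fun z => rfl
  set l : Filter 𝔻 := comap (fun z => ‖(φ z : ℂ)‖) (𝓝[<] 1) with hl
  have hdl : Tendsto (fun z => d ‖(φ z : ℂ)‖) l (𝓝 0) := hd.comp tendsto_comap
  have hsmall : ∀ D, Tendsto (fun z => D * d ‖(φ z : ℂ)‖) l (𝓝 0) := fun D => by
    simpa using hdl.const_mul D
  have key : Tendsto (fun z => ‖T (G z)‖) l (𝓝 0) := by
    refine tendsto_norm_of_isCompactOperator hφ hT hc (M := |D₀| * B + M)
      (fun z => norm_le_of_forall (hbound (φ z))) (fun w => ?_) ?_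
    · obtain ⟨D, hD⟩ := hHb _ w.norm_lt_one
      exact squeeze_zero_norm (fun z => norm_primitive_le fun u hu => hD (φ z) u hu) (hsmall D)
    · refine Metric.tendstoLocallyUniformlyOn_iff.2 fun η hη x hx => ?_
      obtain ⟨r, hxr, hr⟩ := exists_between (mem_ball_zero_iff.1 hx)
      obtain ⟨D, hD⟩ := hHb r hr
      refine ⟨{z | ‖z‖ < r}, mem_nhdsWithin_of_mem_nhds
        ((isOpen_lt continuous_norm continuous_const).mem_nhds hxr), ?_⟩
      filter_upwards [(hsmall D).eventually (gt_mem_nhds hη)] with z hz w hw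
      have hwr : ‖w‖ < r := hw
      lift w to 𝔻 using hwr.trans hr
      rw [toPlane_coe, toPlane_coe, hGt, der_primitive (hH _), Pi.zero_apply, dist_zero_left]
      exact (hD (φ z) w hwr.le).trans_lt hz
  obtain ⟨t, ht, hts⟩ := mem_comap.1 (key.eventually (gt_mem_nhds hε))
  obtain ⟨r, hr, hrt⟩ := (mem_nhdsLT_iff_exists_Ioo_subset).1 ht
  refine ⟨r, hr, fun z hz => ?_⟩
  have h1 : ‖T (G z)‖ < ε := hts (hrt ⟨hz, (φ z).norm_lt_one⟩)
  have h2 := vLog_mul_norm_le (T (G z)) z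
  rw [show (T (G z)).toFun = fun w => G z (φ w) from funext (hT (G z)),
    der_der_comp (G z).isHolo hφ, hGt, der_primitive (hH _)] at h2
  exact h2.trans h1.le

end Necessity

/-! ### Two families of test functions -/

section TestFunctions

open ComplexConjugate

variable (a z : 𝔻)

theorem norm_conj_mul_lt_one : ‖conj (a : ℂ) * z‖ < 1 := by
  rw [norm_mul, Complex.norm_conj]
  exact mul_lt_one_of_nonneg_of_lt_one_left (norm_nonneg _) a.norm_lt_one z.norm_lt_one.le

theorem norm_conj_mul_le_left : ‖conj (a : ℂ) * z‖ ≤ ‖(a : ℂ)‖ := by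
  rw [norm_mul, Complex.norm_conj]
  exact mul_le_of_le_one_right (norm_nonneg _) z.norm_lt_one.le

theorem norm_conj_mul_le_right : ‖conj (a : ℂ) * z‖ ≤ ‖(z : ℂ)‖ := by
  rw [norm_mul, Complex.norm_conj]
  exact mul_le_of_le_one_left (norm_nonneg _) a.norm_lt_one.le

theorem one_sub_norm_le_norm_one_sub (ζ : ℂ) : 1 - ‖ζ‖ ≤ ‖1 - ζ‖ := by
  simpa using norm_sub_norm_le 1 ζ

theorem one_sub_conj_mul_self :
    (1 : ℂ) - conj (a : ℂ) * a = ((1 - ‖(a : ℂ)‖ ^ 2 : ℝ) : ℂ) := by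
  rw [Complex.conj_mul']
  push_cast
  rfl

theorem hasDerivAt_one_sub_mul (b ζ : ℂ) : HasDerivAt (fun z : ℂ => 1 - b * z) (-b) ζ := by
  simpa using ((hasDerivAt_id ζ).const_mul b).const_sub 1

/-- The function `(u² - u) / log (2 / (1 - |a|))` with `u(z) = (1 - |a|²) / (1 - ā z)`. It vanishes
at `a`, where its derivative is comparable to `1 / v_log(a)`. -/
noncomputable def peak (a z : 𝔻) : ℂ :=
  (((1 - ‖(a : ℂ)‖ ^ 2 : ℝ) / (1 - conj (a : ℂ) * z)) ^ 2 -
    (1 - ‖(a : ℂ)‖ ^ 2 : ℝ) / (1 - conj (a : ℂ) * z)) / (Real.log (2 / (1 - ‖(a : ℂ)‖)) : ℝ)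

theorem one_sub_conj_mul_ne_zero : 1 - conj (a : ℂ) * z ≠ 0 := by
  rw [← norm_pos_iff]
  linarith [one_sub_norm_le_norm_one_sub (conj (a : ℂ) * z), norm_conj_mul_lt_one a z]

theorem hasDerivAt_peak : HasDerivAt (fun z : ℂ =>
    (((1 - ‖(a : ℂ)‖ ^ 2 : ℝ) / (1 - conj (a : ℂ) * z)) ^ 2 -
      (1 - ‖(a : ℂ)‖ ^ 2 : ℝ) / (1 - conj (a : ℂ) * z)) / (Real.log (2 / (1 - ‖(a : ℂ)‖)) : ℝ))
    ((2 * ((1 - ‖(a : ℂ)‖ ^ 2 : ℝ) / (1 - conj (a : ℂ) * z)) - 1) *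
      ((1 - ‖(a : ℂ)‖ ^ 2 : ℝ) * conj (a : ℂ) / (1 - conj (a : ℂ) * z) ^ 2) /
        (Real.log (2 / (1 - ‖(a : ℂ)‖)) : ℝ)) z := by
  have h1 := (hasDerivAt_const (z : ℂ) (((1 - ‖(a : ℂ)‖ ^ 2 : ℝ)) : ℂ)).fun_div
    (hasDerivAt_one_sub_mul (conj (a : ℂ)) z) (one_sub_conj_mul_ne_zero a z)
  refine (((h1.fun_pow 2).fun_sub h1).div_const _).congr_deriv ?_
  congr 1
  simp only [Nat.cast_ofNat, Nat.add_one_sub_one, pow_one, zero_mul, zero_sub, mul_neg, neg_neg]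
  ring

theorem isHolo_peak : IsHolo (peak a) :=
  isHolo_of_differentiableOn (fun _ => rfl) fun z hz => by
    lift z to 𝔻 using mem_ball_zero_iff.1 hz
    exact (hasDerivAt_peak a z).differentiableAt.differentiableWithinAt

theorem der_peak : der (peak a) z =
    (2 * ((1 - ‖(a : ℂ)‖ ^ 2 : ℝ) / (1 - conj (a : ℂ) * z)) - 1) *
      ((1 - ‖(a : ℂ)‖ ^ 2 : ℝ) * conj (a : ℂ) / (1 - conj (a : ℂ) * z) ^ 2) /
        (Real.log (2 / (1 - ‖(a : ℂ)‖)) : ℝ) :=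
  der_eq_of_hasDerivAt (fun _ => rfl) (hasDerivAt_peak a z)

theorem half_le_log_two_div : 1 / 2 ≤ Real.log (2 / (1 - ‖(a : ℂ)‖)) := by
  refine half_le_log_two.trans (Real.log_le_log two_pos ?_)
  rw [le_div_iff₀ (one_sub_norm_pos a)]
  linarith [norm_nonneg (a : ℂ)]

theorem one_sub_sq_nonneg : 0 ≤ 1 - ‖(a : ℂ)‖ ^ 2 :=
  (one_sub_sq_pos (norm_nonneg _) a.norm_lt_one).le

theorem norm_div_one_sub_le :
    ‖((1 - ‖(a : ℂ)‖ ^ 2 : ℝ) : ℂ) / (1 - conj (a : ℂ) * z)‖ ≤ 2 := by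
  have hX : 1 - ‖(a : ℂ)‖ ≤ ‖1 - conj (a : ℂ) * z‖ := by
    linarith [one_sub_norm_le_norm_one_sub (conj (a : ℂ) * z), norm_conj_mul_le_left a z]
  have h0 := one_sub_norm_pos a
  rw [norm_div, Complex.norm_real, Real.norm_of_nonneg (one_sub_sq_nonneg a),
    div_le_iff₀ (h0.trans_le hX)]
  nlinarith [norm_nonneg (a : ℂ)]

theorem norm_peak_le : ‖peak a z‖ ≤ 6 * (Real.log (2 / (1 - ‖(a : ℂ)‖)))⁻¹ := by
  have hL : 0 < Real.log (2 / (1 - ‖(a : ℂ)‖)) := by linarith [half_le_log_two_div a]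
  have hu := norm_div_one_sub_le a z
  rw [peak, norm_div, Complex.norm_real, Real.norm_of_nonneg hL.le, div_eq_mul_inv]
  gcongr
  refine (norm_sub_le _ _).trans ?_
  rw [norm_pow]
  nlinarith [norm_nonneg (((1 - ‖(a : ℂ)‖ ^ 2 : ℝ) : ℂ) / (1 - conj (a : ℂ) * z))]

theorem vLog_mul_norm_der_peak_le : vLog z * ‖der (peak a) z‖ ≤ 30 := by
  have hL : 0 < Real.log (2 / (1 - ‖(a : ℂ)‖)) := by linarith [half_le_log_two_div a]
  have hu := norm_div_one_sub_le a z
  have hXy : 1 - ‖(a : ℂ)‖ ≤ ‖1 - conj (a : ℂ) * z‖ := by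
    linarith [one_sub_norm_le_norm_one_sub (conj (a : ℂ) * z), norm_conj_mul_le_left a z]
  have hXx : 1 - ‖(z : ℂ)‖ ≤ ‖1 - conj (a : ℂ) * z‖ := by
    linarith [one_sub_norm_le_norm_one_sub (conj (a : ℂ) * z), norm_conj_mul_le_right a z]
  have hy := one_sub_norm_pos a
  have hx := one_sub_norm_pos z
  have hy1 : 1 - ‖(a : ℂ)‖ ≤ 1 := by linarith [norm_nonneg (a : ℂ)]
  have hv := vLog_pos z
  rw [der_peak, norm_div, norm_mul, norm_div _ ((1 - conj (a : ℂ) * z) ^ 2), norm_mul, norm_pow,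
    Complex.norm_conj, Complex.norm_real, Complex.norm_real, Real.norm_of_nonneg hL.le,
    Real.norm_of_nonneg (one_sub_sq_nonneg a)]
  have h1 : ‖2 * (((1 - ‖(a : ℂ)‖ ^ 2 : ℝ) : ℂ) / (1 - conj (a : ℂ) * z)) - 1‖ ≤ 5 := by
    refine (norm_sub_le _ _).trans ?_
    rw [norm_mul, norm_one, Complex.norm_ofNat]
    linarith
  set X := ‖1 - conj (a : ℂ) * z‖ with hX
  set L := Real.log (2 / (1 - ‖(a : ℂ)‖)) with hLdef
  have h2 : (1 - ‖(a : ℂ)‖ ^ 2) * ‖(a : ℂ)‖ ≤ 2 * (1 - ‖(a : ℂ)‖) := by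
    have := a.norm_lt_one
    have := norm_nonneg (a : ℂ)
    nlinarith [one_sub_sq_nonneg a]
  have hX0 : 0 < X := hy.trans_le hXy
  have h0 := mul_nonneg (one_sub_sq_nonneg a) (norm_nonneg (a : ℂ))
  -- The two regions are `|a| ≥ |z|` and `|z| ≥ |a|`.
  have h3 : vLog z * (1 - ‖(a : ℂ)‖) ≤ 3 * L * X ^ 2 := by
    rcases le_total (1 - ‖(a : ℂ)‖) (1 - ‖(z : ℂ)‖) with h | h
    · have h4 : vLog z ≤ (1 - ‖(z : ℂ)‖) * L := by
        unfold vLog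
        rw [hLdef]
        gcongr
      have h5 : (1 - ‖(z : ℂ)‖) * (1 - ‖(a : ℂ)‖) ≤ X ^ 2 := by nlinarith
      nlinarith
    · have h4 : vLog z ≤ 3 * ((1 - ‖(a : ℂ)‖) * L) := mul_log_two_div_le hx h hy1
      have h5 : (1 - ‖(a : ℂ)‖) * (1 - ‖(a : ℂ)‖) ≤ X ^ 2 := by nlinarith
      nlinarith
  calc vLog z * (‖2 * (((1 - ‖(a : ℂ)‖ ^ 2 : ℝ) : ℂ) / (1 - conj (a : ℂ) * z)) - 1‖ *
        ((1 - ‖(a : ℂ)‖ ^ 2) * ‖(a : ℂ)‖ / X ^ 2) / L)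
      ≤ vLog z * (5 * (2 * (1 - ‖(a : ℂ)‖) / X ^ 2) / L) := by gcongr
    _ = 10 * (vLog z * (1 - ‖(a : ℂ)‖)) / (X ^ 2 * L) := by field_simp; ring
    _ ≤ 30 := by
        rw [div_le_iff₀ (by positivity)]
        linarith

theorem peak_self : peak a a = 0 := by
  have h : (((1 - ‖(a : ℂ)‖ ^ 2 : ℝ)) : ℂ) / (1 - conj (a : ℂ) * a) = 1 := by
    have h1 := one_sub_conj_mul_self a
    have h2 := one_sub_conj_mul_ne_zero a a
    rw [h1] at h2 ⊢
    exact div_self h2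
  rw [peak, h]
  simp

theorem quarter_le_vLog_mul_norm_der_peak (ha : 1 / 2 ≤ ‖(a : ℂ)‖) :
    1 / 4 ≤ vLog a * ‖der (peak a) a‖ := by
  have hL : 0 < Real.log (2 / (1 - ‖(a : ℂ)‖)) := by linarith [half_le_log_two_div a]
  have hy := one_sub_norm_pos a
  have hd := one_sub_sq_pos (norm_nonneg _) a.norm_lt_one
  have hd' : (((1 - ‖(a : ℂ)‖ ^ 2 : ℝ)) : ℂ) ≠ 0 := Complex.ofReal_ne_zero.2 hd.ne'
  have h1 := one_sub_conj_mul_self a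
  have h2 : ‖der (peak a) a‖ =
      ‖(a : ℂ)‖ / ((1 - ‖(a : ℂ)‖ ^ 2) * Real.log (2 / (1 - ‖(a : ℂ)‖))) := by
    rw [der_peak, h1, div_self hd', norm_div, norm_mul, norm_div, norm_mul, norm_pow,
      Complex.norm_conj, Complex.norm_real, Complex.norm_real, Real.norm_of_nonneg hL.le,
      Real.norm_of_nonneg hd.le, show (2 * 1 - 1 : ℂ) = 1 by norm_num, norm_one]
    field_simp
  rw [h2, vLog, mul_div_assoc', le_div_iff₀ (by positivity)]
  have h3 : (1 - ‖(a : ℂ)‖ ^ 2) ≤ 4 * ((1 - ‖(a : ℂ)‖) * ‖(a : ℂ)‖) := by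
    nlinarith [a.norm_lt_one]
  nlinarith

/-- `log (4 / (1 - ζ))`, holomorphic on the unit disc, with positive real part. -/
noncomputable def logFour (ζ : ℂ) : ℂ := (Real.log 4 : ℝ) - Complex.log (1 - ζ)

variable {ζ : ℂ}

theorem one_sub_mem_slitPlane (hζ : ‖ζ‖ < 1) : 1 - ζ ∈ Complex.slitPlane := by
  refine Or.inl ?_
  have := Complex.re_le_norm ζ
  simp only [Complex.sub_re, Complex.one_re]
  linarith

theorem re_logFour (hζ : ‖ζ‖ < 1) : (logFour ζ).re = Real.log (4 / ‖1 - ζ‖) := by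
  have h := Complex.slitPlane_ne_zero (one_sub_mem_slitPlane hζ)
  rw [Real.log_div four_ne_zero (norm_ne_zero_iff.2 h), logFour, Complex.sub_re, Complex.ofReal_re,
    Complex.log_re]

theorem norm_one_sub_le_two (hζ : ‖ζ‖ < 1) : ‖1 - ζ‖ ≤ 2 := by
  have := norm_sub_le 1 ζ
  rw [norm_one] at this
  linarith

theorem half_le_re_logFour (hζ : ‖ζ‖ < 1) : 1 / 2 ≤ (logFour ζ).re := by
  have h := norm_pos_iff.2 (Complex.slitPlane_ne_zero (one_sub_mem_slitPlane hζ))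
  rw [re_logFour hζ]
  refine half_le_log_two.trans (Real.log_le_log two_pos ?_)
  rw [le_div_iff₀ h]
  linarith [norm_one_sub_le_two hζ]

theorem logFour_mem_slitPlane (hζ : ‖ζ‖ < 1) : logFour ζ ∈ Complex.slitPlane :=
  Or.inl (by linarith [half_le_re_logFour hζ])

/-- The imaginary parts of both logarithms are bounded, so the iterated complex logarithm is
controlled by its real counterpart. -/
theorem norm_log_logFour_le {x : ℝ} (hx : x < 1) (hζ : ‖ζ‖ ≤ x) :
    ‖Complex.log (logFour ζ)‖ ≤ 37 * logLog x := by
  have hx0 : 0 ≤ x := (norm_nonneg _).trans hζ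
  have hζ1 := hζ.trans_lt hx
  have hA := one_le_log_div hx0 hx
  have hq := quarter_le_logLog hx0 hx
  set A := Real.log (4 / (1 - x ^ 2)) with hAdef
  have hlow : 1 / 2 ≤ ‖logFour ζ‖ := (half_le_re_logFour hζ1).trans (Complex.re_le_norm _)
  have hre : (logFour ζ).re ≤ A + 1 := by
    have h1 : 1 - x ≤ ‖1 - ζ‖ := by linarith [one_sub_norm_le_norm_one_sub ζ]
    have h2 : 0 < 1 - x := by linarith
    have h3 := one_sub_sq_pos hx0 hx
    have h4 : 4 / ‖1 - ζ‖ ≤ 4 / (1 - x ^ 2) * 2 := by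
      rw [div_mul_eq_mul_div, div_le_div_iff₀ (h2.trans_le h1) h3]
      nlinarith
    rw [re_logFour hζ1]
    refine (Real.log_le_log (div_pos four_pos (h2.trans_le h1)) h4).trans ?_
    rw [Real.log_mul (by positivity) two_ne_zero]
    linarith [Real.log_two_lt_d9]
  have him : |(logFour ζ).im| ≤ 4 := by
    rw [logFour, Complex.sub_im, Complex.ofReal_im, zero_sub, abs_neg, Complex.log_im]
    exact (Complex.abs_arg_le_pi _).trans Real.pi_le_four
  have hup : ‖logFour ζ‖ ≤ 6 * A := by
    refine (Complex.norm_le_abs_re_add_abs_im _).trans ?_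
    rw [abs_of_nonneg (by linarith [half_le_re_logFour hζ1])]
    linarith
  have h1 : Real.log ‖logFour ζ‖ ≤ logLog x + 5 := by
    refine (Real.log_le_log (by linarith) hup).trans ?_
    rw [Real.log_mul (by norm_num) (by linarith)]
    have := Real.log_le_sub_one_of_pos (show (0 : ℝ) < 6 by norm_num)
    unfold logLog
    linarith
  have h2 : -1 ≤ Real.log ‖logFour ζ‖ := by
    have h3 := Real.log_le_log (by norm_num) hlow
    have h4 := Real.one_sub_inv_le_log_of_pos (show (0 : ℝ) < 1 / 2 by norm_num)
    norm_num at h4 h3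
    linarith
  have h3 : |(Complex.log (logFour ζ)).re| ≤ logLog x + 5 := by
    rw [Complex.log_re, abs_le]
    exact ⟨by linarith, h1⟩
  have h4 : |(Complex.log (logFour ζ)).im| ≤ 4 := by
    rw [Complex.log_im]
    exact (Complex.abs_arg_le_pi _).trans Real.pi_le_four
  have := Complex.norm_le_abs_re_add_abs_im (Complex.log (logFour ζ))
  linarith

/-- The function `(log log (4 / (1 - ā z)))² / log log (4 / (1 - |a|²))`. Its value at `a` is
`1 / w_log(a)`. -/
noncomputable def slowPeak (a z : 𝔻) : ℂ :=
  Complex.log (logFour (conj (a : ℂ) * z)) ^ 2 / (logLog ‖(a : ℂ)‖ : ℝ)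

theorem hasDerivAt_slowPeak : HasDerivAt (fun z : ℂ =>
    Complex.log (logFour (conj (a : ℂ) * z)) ^ 2 / (logLog ‖(a : ℂ)‖ : ℝ))
    (2 * Complex.log (logFour (conj (a : ℂ) * z)) *
      (conj (a : ℂ) / (1 - conj (a : ℂ) * z) / logFour (conj (a : ℂ) * z)) /
        (logLog ‖(a : ℂ)‖ : ℝ)) z := by
  have hζ := norm_conj_mul_lt_one a z
  have h1 := ((hasDerivAt_one_sub_mul (conj (a : ℂ)) z).clog
    (one_sub_mem_slitPlane hζ)).const_sub ((Real.log 4 : ℝ) : ℂ)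
  have h2 := ((h1.clog (logFour_mem_slitPlane hζ)).fun_pow 2).div_const (logLog ‖(a : ℂ)‖ : ℂ)
  refine h2.congr_deriv ?_
  simp only [Nat.cast_ofNat, Nat.add_one_sub_one, pow_one, neg_div, neg_neg, logFour]

theorem isHolo_slowPeak : IsHolo (slowPeak a) :=
  isHolo_of_differentiableOn (fun _ => rfl) fun z hz => by
    lift z to 𝔻 using mem_ball_zero_iff.1 hz
    exact (hasDerivAt_slowPeak a z).differentiableAt.differentiableWithinAt

theorem norm_slowPeak_le {r : ℝ} (hr : r < 1) (hz : ‖(z : ℂ)‖ ≤ r) :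
    ‖slowPeak a z‖ ≤ (37 * logLog r) ^ 2 * (logLog ‖(a : ℂ)‖)⁻¹ := by
  have hl := logLog_pos (norm_nonneg _) a.norm_lt_one
  rw [slowPeak, norm_div, norm_pow, Complex.norm_real, Real.norm_of_nonneg hl.le, div_eq_mul_inv]
  gcongr
  exact norm_log_logFour_le hr ((norm_conj_mul_le_right a z).trans hz)

theorem vLog_mul_norm_der_slowPeak_le : vLog z * ‖der (slowPeak a) z‖ ≤ 222 := by
  have hl := logLog_pos (norm_nonneg _) a.norm_lt_one
  have hζ := norm_conj_mul_lt_one a z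
  have hQ := norm_log_logFour_le a.norm_lt_one (norm_conj_mul_le_left a z)
  have hx := one_sub_norm_pos z
  have hXx : 1 - ‖(z : ℂ)‖ ≤ ‖1 - conj (a : ℂ) * z‖ := by
    linarith [one_sub_norm_le_norm_one_sub (conj (a : ℂ) * z), norm_conj_mul_le_right a z]
  have hX2 := norm_one_sub_le_two hζ
  have hΛ := (re_logFour hζ).symm.trans_le (Complex.re_le_norm _)
  have hΛ0 := (half_le_re_logFour hζ).trans (Complex.re_le_norm _)
  rw [der_eq_of_hasDerivAt (f := slowPeak a) (fun _ => rfl) (hasDerivAt_slowPeak a z),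
    norm_div, norm_mul, norm_mul, norm_div, norm_div, Complex.norm_conj, Complex.norm_real,
    Real.norm_of_nonneg hl.le, Complex.norm_ofNat]
  set X := ‖1 - conj (a : ℂ) * z‖ with hX
  set Λ := ‖logFour (conj (a : ℂ) * z)‖ with hΛdef
  have hX0 : 0 < X := hx.trans_le hXx
  -- Halving both arguments brings `X ∈ (0, 2]` into the range of almost monotonicity.
  have h1 : vLog z ≤ 3 * (X * Λ) := by
    have h2 := mul_log_two_div_le (x := X / 2) (y := (1 - ‖(z : ℂ)‖) / 2) (by linarith)
      (by linarith) (by linarith)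
    rw [div_div_eq_mul_div, div_div_eq_mul_div, show (2 : ℝ) * 2 = 4 by norm_num] at h2
    have h3 : Real.log (2 / (1 - ‖(z : ℂ)‖)) ≤ Real.log (4 / (1 - ‖(z : ℂ)‖)) :=
      Real.log_le_log (by positivity) (by gcongr; norm_num)
    have h4 : vLog z ≤ (1 - ‖(z : ℂ)‖) * Real.log (4 / (1 - ‖(z : ℂ)‖)) :=
      mul_le_mul_of_nonneg_left h3 hx.le
    have h5 : X * Real.log (4 / X) ≤ X * Λ := mul_le_mul_of_nonneg_left hΛ hX0.le
    linarith
  have hΛpos : 0 < Λ := by linarith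
  have hv := (vLog_pos z).le
  calc vLog z * (2 * ‖Complex.log (logFour (conj (a : ℂ) * z))‖ * (‖(a : ℂ)‖ / X / Λ) /
        logLog ‖(a : ℂ)‖)
      ≤ vLog z * (2 * (37 * logLog ‖(a : ℂ)‖) * (1 / X / Λ) / logLog ‖(a : ℂ)‖) := by
        gcongr
        exact a.norm_lt_one.le
    _ = 74 * vLog z / (X * Λ) := by field_simp; ring
    _ ≤ 222 := by
        rw [div_le_iff₀ (by positivity)]
        linarith

theorem slowPeak_self : slowPeak a a = (logLog ‖(a : ℂ)‖ : ℝ) := by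
  have hl := logLog_pos (norm_nonneg _) a.norm_lt_one
  have hd := one_sub_sq_pos (norm_nonneg _) a.norm_lt_one
  have hA := one_le_log_div (norm_nonneg _) a.norm_lt_one
  have h1 := one_sub_conj_mul_self a
  have h2 : logFour (conj (a : ℂ) * a) = (Real.log (4 / (1 - ‖(a : ℂ)‖ ^ 2)) : ℝ) := by
    rw [logFour, h1, ← Complex.ofReal_log hd.le, ← Complex.ofReal_sub,
      Real.log_div four_ne_zero hd.ne']
  rw [slowPeak, h2, ← Complex.ofReal_log (by linarith), ← Complex.ofReal_pow,
    ← Complex.ofReal_div]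
  congr 1
  change logLog ‖(a : ℂ)‖ ^ 2 / _ = _
  field_simp

end TestFunctions

/-! ### Compactness implies the decay conditions -/

section Compactness

variable {φ : 𝔻 → 𝔻} {T : ZygmundSpace →L[ℂ] ZygmundSpace}

/-- The operator is applied to the functions `z` and `z²`. -/
theorem exists_bounds_of_continuousLinearMap (hφ : IsHolo (fun z => (φ z : ℂ)))
    (hT : ∀ (f : ZygmundSpace) (z : 𝔻), T f z = f (φ z)) :
    (∃ K, ∀ z, vLog z * ‖der (fun z => (φ z : ℂ)) z‖ ^ 2 ≤ K) ∧
      ∃ K, ∀ z, vLog z * ‖der (der (fun z => (φ z : ℂ))) z‖ ≤ K := by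
  have hd1 : der (fun z : 𝔻 => (z : ℂ)) = fun _ => 1 := funext der_coe
  have hdd1 : der (fun _ : 𝔻 => (1 : ℂ)) = 0 := funext fun z =>
    der_eq_of_hasDerivAt (g := fun _ => 1) (fun _ => rfl) (hasDerivAt_const _ _)
  have hd2 : der (fun z : 𝔻 => (z : ℂ) * z) = fun z : 𝔻 => 2 * (z : ℂ) := funext fun z => by
    rw [der_mul isHolo_coe isHolo_coe, der_coe]
    ring
  have hdd2 : der (fun z : 𝔻 => 2 * (z : ℂ)) = fun _ => 2 := funext fun z =>
    der_eq_of_hasDerivAt (g := fun z => 2 * z) (fun _ => rfl)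
      (by simpa using (hasDerivAt_id (z : ℂ)).const_mul 2)
  obtain ⟨f₁, hf₁⟩ : ∃ f : ZygmundSpace, f.toFun = fun z : 𝔻 => (z : ℂ) :=
    ⟨.ofBound _ isHolo_coe 1 (fun z => by rw [hd1, hdd1]; simp), rfl⟩
  obtain ⟨f₂, hf₂⟩ : ∃ f : ZygmundSpace, f.toFun = fun z : 𝔻 => (z : ℂ) * z := by
    refine ⟨.ofBound _ (isHolo_coe.mul isHolo_coe) 6 (fun z => ?_), rfl⟩
    rw [hd2, hdd2]
    simp only [Complex.UnitDisc.coe_zero, mul_zero, norm_zero, zero_add, Complex.norm_ofNat]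
    linarith [vLog_le z]
  have hT₁ : ∀ z, vLog z * ‖der (der (fun z => (φ z : ℂ))) z‖ ≤ ‖T f₁‖ := fun z => by
    have h := vLog_mul_norm_le (T f₁) z
    rwa [show (T f₁).toFun = fun w => (φ w : ℂ) from funext fun w => by rw [hT, hf₁]] at h
  refine ⟨⟨(‖T f₂‖ + 2 * ‖T f₁‖) / 2, fun z => ?_⟩, ‖T f₁‖, hT₁⟩
  have h := vLog_mul_norm_le (T f₂) z
  rw [show (T f₂).toFun = fun w => f₂ (φ w) from funext (hT f₂), der_der_comp f₂.isHolo hφ, hf₂,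
    hd2, hdd2] at h
  have h1 := hT₁ z
  set p := der (fun z => (φ z : ℂ)) z
  set s := der (der (fun z => (φ z : ℂ))) z
  have hv := (vLog_pos z).le
  have h2 : 2 * ‖p‖ ^ 2 ≤ ‖2 * p ^ 2 + 2 * (φ z : ℂ) * s‖ + 2 * ‖s‖ := by
    have h3 := norm_sub_le (2 * p ^ 2 + 2 * (φ z : ℂ) * s) (2 * (φ z : ℂ) * s)
    rw [add_sub_cancel_right, norm_mul, norm_pow, norm_mul (2 * (φ z : ℂ)) s, norm_mul 2 (φ z : ℂ),
      Complex.norm_ofNat] at h3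
    have h4 := mul_le_mul_of_nonneg_right (φ z).norm_lt_one.le (norm_nonneg s)
    linarith
  have h3 := mul_le_mul_of_nonneg_left h2 hv
  linarith

theorem boundaryVanishing_vLog_of_isCompactOperator (hφ : IsHolo (fun z => (φ z : ℂ)))
    (hT : ∀ (f : ZygmundSpace) (z : 𝔻), T f z = f (φ z)) (hc : IsCompactOperator T) :
    BoundaryVanishing φ vLog (fun z => vLog z * ‖der (fun z => (φ z : ℂ)) z‖ ^ 2) := by
  intro ε hε
  obtain ⟨r, hr, h⟩ := exists_forall_le_of_isCompactOperator hφ hT hc (H := peak)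
    (d := fun r => (Real.log (2 / (1 - r)))⁻¹) (B := 2) isHolo_peak vLog_mul_norm_der_peak_le
    (fun a => by
      have h := half_le_log_two_div a
      rw [abs_of_nonneg (inv_nonneg.2 (by linarith)), inv_le_comm₀ (by linarith) two_pos,
        inv_eq_one_div]
      exact h)
    tendsto_inv_log_two_div (fun r _ => ⟨6, fun a z _ => norm_peak_le a z⟩)
    (show 0 < ε / 4 by positivity)
  refine ⟨max r (1 / 2), max_lt hr (by norm_num), fun z hz => ?_⟩
  have h1 := h z ((le_max_left _ _).trans_lt hz)
  have h2 := quarter_le_vLog_mul_norm_der_peak (φ z) ((le_max_right _ _).trans hz.le)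
  rw [peak_self, zero_mul, add_zero, norm_mul, norm_pow] at h1
  have hq : 0 ≤ vLog z * ‖der (fun z => (φ z : ℂ)) z‖ ^ 2 :=
    mul_nonneg (vLog_pos z).le (by positivity)
  have h3 := mul_le_mul_of_nonneg_left h1 (vLog_pos (φ z)).le
  have h4 := mul_le_mul_of_nonneg_right h2 hq
  linarith

theorem boundaryVanishing_wLog_of_isCompactOperator (hφ : IsHolo (fun z => (φ z : ℂ)))
    (hT : ∀ (f : ZygmundSpace) (z : 𝔻), T f z = f (φ z)) (hc : IsCompactOperator T) :
    BoundaryVanishing φ wLog (fun z => vLog z * ‖der (der (fun z => (φ z : ℂ))) z‖) := by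
  intro ε hε
  obtain ⟨r, hr, h⟩ := exists_forall_le_of_isCompactOperator hφ hT hc (H := slowPeak)
    (d := fun r => (logLog r)⁻¹) (B := 4) isHolo_slowPeak vLog_mul_norm_der_slowPeak_le
    (fun a => by
      have h := quarter_le_logLog (norm_nonneg _) a.norm_lt_one
      rw [abs_of_nonneg (inv_nonneg.2 (by linarith)), inv_le_comm₀ (by linarith) four_pos,
        inv_eq_one_div]
      exact h)
    tendsto_inv_logLog (fun r hr => ⟨_, fun a z hz => norm_slowPeak_le a z hr hz⟩)
    (half_pos hε)
  obtain ⟨r', hr', h'⟩ := boundaryVanishing_vLog_of_isCompactOperator hφ hT hc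
    (ε / 444) (by positivity)
  refine ⟨max r r', max_lt hr hr', fun z hz => ?_⟩
  have h1 := h z ((le_max_left _ _).trans_lt hz)
  have h2 := h' z ((le_max_right _ _).trans_lt hz)
  have h3 := vLog_mul_norm_der_slowPeak_le (φ z) (φ z)
  have hl := logLog_pos (norm_nonneg _) (φ z).norm_lt_one
  have hv := (vLog_pos z).le
  rw [slowPeak_self] at h1
  set p := der (fun z => (φ z : ℂ)) z
  set s := der (der (fun z => (φ z : ℂ))) z
  set P := der (slowPeak (φ z)) (φ z)
  have h4 : logLog ‖(φ z : ℂ)‖ * ‖s‖ ≤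
      ‖P * p ^ 2 + (logLog ‖(φ z : ℂ)‖ : ℝ) * s‖ + ‖p‖ ^ 2 * ‖P‖ := by
    have h5 := norm_sub_le (P * p ^ 2 + (logLog ‖(φ z : ℂ)‖ : ℝ) * s) (P * p ^ 2)
    rw [add_sub_cancel_left, norm_mul, norm_mul P, norm_pow, Complex.norm_real,
      Real.norm_of_nonneg hl.le] at h5
    linarith
  have h6 : vLog z * ‖p‖ ^ 2 * ‖P‖ ≤ ε / 2 := by
    calc vLog z * ‖p‖ ^ 2 * ‖P‖ ≤ ε / 444 * vLog (φ z) * ‖P‖ := by gcongr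
      _ = ε / 444 * (vLog (φ z) * ‖P‖) := by ring
      _ ≤ ε / 444 * 222 := by gcongr
      _ = ε / 2 := by ring
  have h7 := mul_le_mul_of_nonneg_left h4 hv
  rw [wLog_eq, ← div_eq_mul_inv, le_div_iff₀ hl]
  linarith

end Compactness

/-- Compactness in terms of the pointwise decay of `v_log |φ'|²` and `v_log |φ''|`. -/
theorem isCompactComposition_iff {φ : 𝔻 → 𝔻} (hφ : IsHolo (fun z => (φ z : ℂ))) :
    IsCompactComposition φ ↔
      ((∃ K, ∀ z, vLog z * ‖der (fun z => (φ z : ℂ)) z‖ ^ 2 ≤ K) ∧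
        ∃ K, ∀ z, vLog z * ‖der (der (fun z => (φ z : ℂ))) z‖ ≤ K) ∧
      BoundaryVanishing φ vLog (fun z => vLog z * ‖der (fun z => (φ z : ℂ)) z‖ ^ 2) ∧
      BoundaryVanishing φ wLog (fun z => vLog z * ‖der (der (fun z => (φ z : ℂ))) z‖) := by
  constructor
  · rintro ⟨T, hT, hc⟩
    exact ⟨exists_bounds_of_continuousLinearMap hφ hT,
      boundaryVanishing_vLog_of_isCompactOperator hφ hT hc,
      boundaryVanishing_wLog_of_isCompactOperator hφ hT hc⟩
  · rintro ⟨⟨⟨K₁, hK₁⟩, K₂, hK₂⟩, h₁, h₂⟩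
    exact isCompactComposition_of_boundaryVanishing hφ hK₁ hK₂ h₁ h₂

theorem exists_le_of_powSup_lt_top {φ : 𝔻 → 𝔻} {q : 𝔻 → ℝ} (h : powSup φ q 0 < ∞) :
    ∃ K, ∀ z, q z ≤ K := by
  refine ⟨(powSup φ q 0).toReal, fun z => ?_⟩
  have h1 := le_powSup φ q 0 z
  rw [pow_zero, mul_one] at h1
  exact (ENNReal.ofReal_le_iff_le_toReal h.ne).1 h1

theorem tendsto_powSup_div_iff {φ : 𝔻 → 𝔻} {w q : 𝔻 → ℝ} (hq : ∀ z, 0 ≤ q z) {K : ℝ}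
    (hK : ∀ z, q z ≤ K) (hw : SlowWeight w) (hpos : ∀ z, 0 < w z) :
    Tendsto (fun n : ℕ => ((n : ℝ≥0∞) + 2) * ((n : ℝ≥0∞) + 1) * powSup φ q n /
      zygENorm w (power (n + 2))) atTop (𝓝 0) ↔ BoundaryVanishing φ w q := by
  have h : (fun n : ℕ => ((n : ℝ≥0∞) + 2) * ((n : ℝ≥0∞) + 1) * powSup φ q n /
      zygENorm w (power (n + 2))) = fun n => powSup φ q n / powSup id w n := by
    funext n
    rw [zygENorm_power_add_two fun z => (hpos z).le]
    refine ENNReal.mul_div_mul_left _ _ (by positivity) ?_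
    exact ENNReal.mul_ne_top (by simp) (by simp)
  rw [h]
  exact ⟨boundaryVanishing_of_tendsto hq hw hpos, tendsto_of_boundaryVanishing hq hK hw hpos⟩

end LogZygmund

theorem mainTheorem6 (φ : 𝔻 → 𝔻) (hφ : IsHolo (fun z => (φ z : ℂ))) :
    IsCompactComposition φ ↔
      (∀ n : ℕ,
        zygENorm vLog
          (opJ' (der (fun z => (φ z : ℂ))) (fun z => (φ z : ℂ) ^ n)) < ∞ ∧
        zygENorm vLog
          (opI' (der (fun z => (φ z : ℂ))) (fun z => (φ z : ℂ) ^ n)) < ∞) ∧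
      Tendsto (fun n : ℕ =>
        ((n : ℝ≥0∞) + 2) * ((n : ℝ≥0∞) + 1) *
          zygENorm vLog
            (opJ' (der (fun z => (φ z : ℂ))) (fun z => (φ z : ℂ) ^ n)) /
          zygENorm wLog (power (n + 2))) atTop (𝓝 0) ∧
      Tendsto (fun n : ℕ =>
        ((n : ℝ≥0∞) + 1) *
          zygENorm vLog
            (opI' (der (fun z => (φ z : ℂ))) (fun z => (φ z : ℂ) ^ n)) /
          zygENorm vLog (power (n + 1))) atTop (𝓝 0) := by
  have hq₁ : ∀ z, 0 ≤ vLog z * ‖der (fun z => (φ z : ℂ)) z‖ ^ 2 := fun z =>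
    mul_nonneg (vLog_pos z).le (by positivity)
  have hq₂ : ∀ z, 0 ≤ vLog z * ‖der (der (fun z => (φ z : ℂ))) z‖ := fun z =>
    mul_nonneg (vLog_pos z).le (norm_nonneg _)
  have hbounds : (∀ n : ℕ,
      zygENorm vLog (opJ' (der (fun z => (φ z : ℂ))) (fun z => (φ z : ℂ) ^ n)) < ∞ ∧
      zygENorm vLog (opI' (der (fun z => (φ z : ℂ))) (fun z => (φ z : ℂ) ^ n)) < ∞) ↔
      (∃ K, ∀ z, vLog z * ‖der (fun z => (φ z : ℂ)) z‖ ^ 2 ≤ K) ∧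
        ∃ K, ∀ z, vLog z * ‖der (der (fun z => (φ z : ℂ))) z‖ ≤ K := by
    constructor
    · intro h
      have hJ := (h 0).1
      have hI := (h 1).2
      rw [zygENorm_opJ' hφ] at hJ
      rw [zygENorm_opI'_succ hφ 0, Nat.cast_zero, zero_add, one_mul] at hI
      exact ⟨exists_le_of_powSup_lt_top hI, exists_le_of_powSup_lt_top hJ⟩
    · rintro ⟨⟨K₁, hK₁⟩, K₂, hK₂⟩ n
      refine ⟨by rw [zygENorm_opJ' hφ]; exact powSup_lt_top hq₂ hK₂ n, ?_⟩
      cases n with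
      | zero => rw [zygENorm_opI'_zero hφ]; exact ENNReal.zero_lt_top
      | succ n =>
        rw [zygENorm_opI'_succ hφ]
        exact ENNReal.mul_lt_top (by simp) (powSup_lt_top hq₁ hK₁ n)
  rw [isCompactComposition_iff hφ, hbounds]
  refine and_congr_right ?_
  rintro ⟨⟨K₁, hK₁⟩, K₂, hK₂⟩
  rw [and_comm]
  refine and_congr ?_ ?_
  · simp only [zygENorm_opJ' hφ]
    exact (tendsto_powSup_div_iff hq₂ hK₂ slowWeight_wLog wLog_pos).symm
  · rw [← tendsto_powSup_div_iff hq₁ hK₁ slowWeight_vLog vLog_pos]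
    refine Iff.trans ?_ (tendsto_add_atTop_iff_nat 1)
    refine iff_of_eq (congrArg (fun F => Tendsto F atTop (𝓝 0)) (funext fun n => ?_))
    rw [zygENorm_opI'_succ hφ, ← mul_assoc]
    push_cast
    rw [show (n : ℝ≥0∞) + 1 + 1 = n + 2 by rw [add_assoc, one_add_one_eq_two]]
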